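/- Let $R$ be a commutative ring with unit, $n\ge 1$, and $X=\{x_1<\dots<x_n\}$ an ordered alphabet with $n$ letters. A *two-colored graph* on $X$ is a finite loopless multigraph with vertex set $X$ each of whose edges is colored red or blue; an *oriented two-colored graph* is a two-colored graph each of whose edges is given a direction. Graphs may have several edges between the same two vertices and may be disconnected. Let $\Gamma_n$ be the free $R$-module on the set of all oriented two-colored graphs on $X$, and let $I_n\subset\Gamma_n$ be the submodule generated by the following elements, where $H$ is any oriented two-colored graph, $i,j,k$ are distinct letters, $i\xrightarrow{c}j$ is an edge of color $c\in\{r,b\}$ ($r$ red, $b$ blue), and $H+e+f$ is $H$ with the edges $e,f$ added: * symmetry combinations: $(H+(i\xrightarrow{c}j))+(H+(j\xrightarrow{c}i))$; * Jacobi combinations: $\displaystyle\sum_{(p,q,s)}\bigl(H+(p\xrightarrow{c}q)+(q\xrightarrow{c}s)\bigr)$, for $c\in\{r,b\}$; * mixed Jacobi combinations: $\displaystyle\sum_{(p,q,s)}\Bigl[\bigl(H+(p\xrightarrow{b}q)+(q\xrightarrow{r}s)\bigr)+\bigl(H+(p\xrightarrow{r}q)+(q\xrightarrow{b}s)\bigr)\Bigr]$;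 * every oriented two-colored graph with more than one edge between some two vertices, and every disconnected oriented two-colored graph; here $(p,q,s)$ runs over the three cyclic rotations $(i,j,k),(j,k,i),(k,i,j)$. Put $\mathcal{E}il_2(n)=\Gamma_n/I_n$. Let $\overline{\mathcal G}_n$ be the set of two-colored trees on $X$ (connected, acyclic) such that there are no letters $i<j<k$ for which (a) $\{i,k\}$ and $\{j,k\}$ are both red edges, or (b) $\{i,j\}$ and $\{i,k\}$ are both blue edges, or (c) $\{i,j\}$ is a red edge and $\{j,k\}$ is a blue edge. (These are the trees obtained from the rooted trees on $X$ by coloring an edge red if the parent is smaller than the child and blue if it is larger, and forgetting the root.) For $G\in\overline{\mathcal G}_n$ let the oriented copy $o_G$ be the oriented two-colored graph obtained by orienting each edge $\{i,j\}$ with $i<j$ as $i\to j$ if it is red and as $j\to i$ if it is blue, and let $\mathcal O_n(X)=\{o_G : G\in\overline{\mathcal G}_n\}$. Then $\mathcal{E}il_2(n)$ is a free $R$-module of rank $n^{n-1}$ (that is, $\mathcal{E}il_2(n)\cong R^{n^{n-1}}$), and the classes of the elements of $\mathcal O_n(X)$, as a family indexed by $\mathcal O_n(X)$, form a basis of $\mathcal{E}il_2(n)$.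 -/

import Mathlib

namespace EilTwo

/-- The two colours of edges. -/
inductive EdgeColor : Type
  | red
  | blue

/-! ### Unoriented two-coloured graphs on an ordered alphabet `X` -/

/-- A coloured edge `{lo, hi}` joining two distinct letters; as `X` is totally ordered, a two-element
subset of `X` is recorded by its smaller letter `lo` and its larger letter `hi`. -/
structure Edge (X : Type*) [LinearOrder X] where
  lo : X
  hi : X
  lt : lo < hi
  color : EdgeColor

/-- A two-coloured graph with vertex set `X`: a finite multiset of coloured edges (no loops;
several edges may join the same two vertices). -/
abbrev Graph (X : Type*) [LinearOrder X] := Multiset (Edge X)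

namespace Graph

variable {X : Type*} [LinearOrder X]

/-- The simple graph on `X` in which two letters are adjacent if some edge of `G` joins them. -/
def toSimpleGraph (G : Graph X) : SimpleGraph X :=
  SimpleGraph.fromRel fun i j => ∃ e ∈ G, e.lo = i ∧ e.hi = j

/-- `G` is a tree on `X`: connected and acyclic, the latter meaning that no two edges of `G` join the
same two vertices and that there is no cycle of length at least three. -/
def IsTree (G : Graph X) : Prop :=
  (G.map fun e => (e.lo, e.hi)).Nodup ∧ G.toSimpleGraph.IsTree

/-- For `i < j`: `{i, j}` is an edge of `G` of colour `c`. -/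
def HasEdge (G : Graph X) (c : EdgeColor) (i j : X) : Prop :=
  ∃ e ∈ G, e.lo = i ∧ e.hi = j ∧ e.color = c

/-- The pattern `1r3r2`. -/
def HasPattern1r3r2 (G : Graph X) : Prop :=
  ∃ i j k : X, i < j ∧ j < k ∧ G.HasEdge .red i k ∧ G.HasEdge .red j k

/-- The pattern `2b1b3`. -/
def HasPattern2b1b3 (G : Graph X) : Prop :=
  ∃ i j k : X, i < j ∧ j < k ∧ G.HasEdge .blue i j ∧ G.HasEdge .blue i k

/-- The pattern `1r2b3`. -/
def HasPattern1r2b3 (G : Graph X) : Prop :=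
  ∃ i j k : X, i < j ∧ j < k ∧ G.HasEdge .red i j ∧ G.HasEdge .blue j k

end Graph

/-- The set of two-coloured trees on `X` avoiding the three patterns. These are the trees obtained
from the rooted trees on `X` by colouring an edge red if the parent is smaller than the child, and
blue if it is larger, and forgetting the root. -/
def avoidingTrees (X : Type*) [LinearOrder X] : Set (Graph X) :=
  {G | G.IsTree ∧ ¬ G.HasPattern1r3r2 ∧ ¬ G.HasPattern2b1b3 ∧ ¬ G.HasPattern1r2b3}

/-! ### Oriented two-coloured graphs -/

/-- A coloured oriented edge `src → tgt` between two distinct letters. -/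
structure Arc (X : Type*) where
  src : X
  tgt : X
  ne : src ≠ tgt
  color : EdgeColor

/-- The same edge with the opposite orientation. -/
def Arc.reverse {X : Type*} (a : Arc X) : Arc X := ⟨a.tgt, a.src, a.ne.symm, a.color⟩

/-- `a` and `b` join the same two vertices (whatever their orientations and colours). -/
def Arc.Parallel {X : Type*} (a b : Arc X) : Prop :=
  (a.src = b.src ∧ a.tgt = b.tgt) ∨ (a.src = b.tgt ∧ a.tgt = b.src)

/-- An oriented two-coloured graph with vertex set `X`: a finite multiset of coloured oriented edges.
Multiple edges and disconnected graphs are allowed. -/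
abbrev OGraph (X : Type*) := Multiset (Arc X)

/-- The simple graph on `X` in which two letters are adjacent if some oriented edge of `G` joins
them, in either direction. -/
def OGraph.toSimpleGraph {X : Type*} (G : OGraph X) : SimpleGraph X :=
  SimpleGraph.fromRel fun i j => ∃ a ∈ G, a.src = i ∧ a.tgt = j

/-- The consistent orientation of an edge: from the smaller to the larger letter if it is red, from
the larger to the smaller letter if it is blue. -/
def Edge.orient {X : Type*} [LinearOrder X] : Edge X → Arc X
  | ⟨lo, hi, lt, .red⟩ => ⟨lo, hi, lt.ne, .red⟩
  | ⟨lo, hi, lt, .blue⟩ => ⟨hi, lo, lt.ne', .blue⟩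

/-- The oriented copy `o_G` of a two-coloured graph `G`: every edge gets its consistent
orientation. -/
def Graph.orientedCopy {X : Type*} [LinearOrder X] (G : Graph X) : OGraph X :=
  G.map Edge.orient

/-- The set `O_n(X)` of the oriented copies of the pattern-avoiding two-coloured trees. -/
def orientedTrees (X : Type*) [LinearOrder X] : Set (OGraph X) :=
  Graph.orientedCopy '' avoidingTrees X

/-! ### The module `Eil_2` -/

section Module

variable (R : Type*) [CommRing R] (X : Type*)

/-- The free `R`-module `Γ` on the oriented two-coloured graphs. -/
abbrev Gam := OGraph X →₀ R

variable {X} in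
/-- The basis element of `Γ` given by a graph. -/
noncomputable def single (G : OGraph X) : Gam R X := Finsupp.single G 1

/-- Symmetry combinations: `G₁ + G₂`, where `G₂` is `G₁` with the orientation of one edge
switched. -/
def symmetryCombinations : Set (Gam R X) :=
  {x | ∃ (H : OGraph X) (a : Arc X), x = single R (a ::ₘ H) + single R (a.reverse ::ₘ H)}

/-- Jacobi combinations: for distinct `i, j, k` and a colour `c`, the sum of the three graphs obtained
from `i → j`, `j → k` (both of colour `c`) by cyclic rotation of `i, j, k`, the rest `H` of the graph
being fixed. -/
def jacobiCombinations : Set (Gam R X) :=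
  {x | ∃ (H : OGraph X) (i j k : X) (hij : i ≠ j) (hjk : j ≠ k) (hki : k ≠ i) (c : EdgeColor),
    x = single R (⟨i, j, hij, c⟩ ::ₘ ⟨j, k, hjk, c⟩ ::ₘ H)
      + single R (⟨j, k, hjk, c⟩ ::ₘ ⟨k, i, hki, c⟩ ::ₘ H)
      + single R (⟨k, i, hki, c⟩ ::ₘ ⟨i, j, hij, c⟩ ::ₘ H)}

/-- Mixed Jacobi combinations: the sum of two copies of a red Jacobi combination, where in each of the
three graphs one of the two edges is made blue in the first copy, and the other edge in the second
copy. -/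
def mixedJacobiCombinations : Set (Gam R X) :=
  {x | ∃ (H : OGraph X) (i j k : X) (hij : i ≠ j) (hjk : j ≠ k) (hki : k ≠ i),
    x = (single R (⟨i, j, hij, .blue⟩ ::ₘ ⟨j, k, hjk, .red⟩ ::ₘ H)
      + single R (⟨j, k, hjk, .blue⟩ ::ₘ ⟨k, i, hki, .red⟩ ::ₘ H)
      + single R (⟨k, i, hki, .blue⟩ ::ₘ ⟨i, j, hij, .red⟩ ::ₘ H))
      + (single R (⟨i, j, hij, .red⟩ ::ₘ ⟨j, k, hjk, .blue⟩ ::ₘ H)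
      + single R (⟨j, k, hjk, .red⟩ ::ₘ ⟨k, i, hki, .blue⟩ ::ₘ H)
      + single R (⟨k, i, hki, .red⟩ ::ₘ ⟨i, j, hij, .blue⟩ ::ₘ H))}

/-- Graphs with more than one edge between two vertices. -/
def multipleEdgeGraphs : Set (Gam R X) :=
  {x | ∃ (H : OGraph X) (a b : Arc X), a.Parallel b ∧ x = single R (a ::ₘ b ::ₘ H)}

/-- Disconnected graphs. -/
def disconnectedGraphs : Set (Gam R X) :=
  {x | ∃ G : OGraph X, ¬ G.toSimpleGraph.Connected ∧ x = single R G}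

/-- The submodule `I` of relations. -/
noncomputable def relations : Submodule R (Gam R X) :=
  Submodule.span R (symmetryCombinations R X ∪ jacobiCombinations R X ∪
    mixedJacobiCombinations R X ∪ multipleEdgeGraphs R X ∪ disconnectedGraphs R X)

/-- The module `Eil_2 = Γ / I`. -/
abbrev Eil := Gam R X ⧸ relations R X

variable {X} in
/-- The class in `Eil_2` of an oriented two-coloured graph. -/
noncomputable def Eil.mk (G : OGraph X) : Eil R X := (relations R X).mkQ (single R G)

end Module

end EilTwo

/-! The normal forms are the rooted trees whose arcs point away from the root and carry the colour
dictated by the order of their ends. The three patterns say that no two consistently oriented edges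
of a tree enter the same letter, and a tree with this property is rooted; this is
`orientedTrees_eq`. Three facts remain: rooted trees generate, they are independent, and there are
`n ^ (n - 1)` of them.

Generation. A disconnected graph is a relation. A connected graph with more arcs than a spanning
tree contains a cycle, which Jacobi and mixed Jacobi relations shorten until two edges become
parallel (`mem_of_cycle`). In a tree, symmetry makes every arc consistent up to sign.
`DTree.mem_rootedSpan` then inducts on the number of letters: a leaf entered by its arc is removed
and grafted back, while a leaf whose arc leaves it for a rooted tree is handled by
`mem_of_rooted_chain`, which moves the point of attachment towards the root while the letters passed
on the way build up a monotone path. Two arcs entering a letter from the same side are resolved by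
Jacobi (`mem_same`), from opposite sides by mixed Jacobi (`mem_opposite`).

Independence. A binary tree with coloured internal vertices defines a functional: at each internal
vertex exactly one arc must run between the two sets of leaves, and it contributes `0` or a sign
according to its colour and direction. These functionals kill all relations
(`functional_relations`). They separate rooted trees (`eq_zero_of_functional_eq_zero`): in a
combination that they kill, take a tree of maximal `rank`, cut it at a root arc and apply induction
to both halves. Every other way of gluing the halves into a rooted tree by an arc of that colour has
larger `rank` (`rank_lt`), so the coefficient of the chosen tree vanishes. The decisive pairing
coefficient is `1`, so no assumption on `R` is needed.

Enumeration. Rooted trees are acyclic parent functions with one root, and deleting arcs one at a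
time gives a recursion on the number of roots of a forest (`card_forests_succ`). -/

namespace EilTwo

variable {R : Type*} [CommRing R] {X : Type*} [LinearOrder X]

/-! ### Coloured arcs as graphs -/

/-- The graph with the single arc `u → v` of colour `c` (empty if `u = v`). -/
def carc (c : EdgeColor) (u v : X) : OGraph X := if h : u ≠ v then {⟨u, v, h, c⟩} else 0

/-- The colour which makes `u → v` a consistently oriented arc. -/
def colorOf (u v : X) : EdgeColor := if u < v then .red else .blue

/-- The graph with the single consistently oriented arc `u → v`. -/
def outArc (u v : X) : OGraph X := carc (colorOf u v) u v

theorem carc_of_ne {c : EdgeColor} {u v : X} (h : u ≠ v) : carc c u v = {⟨u, v, h, c⟩} := by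
  simp [carc, h]

theorem colorOf_red {u v : X} (h : u < v) : colorOf u v = .red := by simp [colorOf, h]

theorem colorOf_blue {u v : X} (h : v < u) : colorOf u v = .blue := by
  simp [colorOf, h.not_gt]

theorem mem_outArc {a : Arc X} {u v : X} :
    a ∈ outArc u v ↔ a.src = u ∧ a.tgt = v ∧ a.color = colorOf a.src a.tgt := by
  rcases a with ⟨s, t, h, c⟩
  by_cases e : u = v
  · subst e
    simp only [outArc, carc, ne_eq, not_true_eq_false, dite_false, Multiset.notMem_zero, false_iff]
    rintro ⟨rfl, h2, -⟩
    exact h h2.symm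
  · rw [outArc, carc_of_ne e, Multiset.mem_singleton]
    constructor
    · intro h'; cases h'; simp
    · rintro ⟨rfl, rfl, h3⟩; simp only at h3; subst h3; rfl

/-! ### Rooted trees and directed trees of consistent arcs -/

/-- `G` is a rooted tree on the vertex set `Y` with root `r`, its arcs being consistently oriented and
pointing away from the root. -/
inductive RootedTree : Finset X → X → OGraph X → Prop
  | point (r : X) : RootedTree {r} r 0
  | graft {Y : Finset X} {r : X} {G : OGraph X} {w x : X} (h : RootedTree Y r G) (hw : w ∈ Y)
      (hx : x ∉ Y) : RootedTree (insert x Y) r (outArc w x + G)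

/-- `G` is a tree on the vertex set `Y` all of whose arcs are consistently oriented. -/
inductive DTree : Finset X → OGraph X → Prop
  | point (r : X) : DTree {r} 0
  | out {Y : Finset X} {G : OGraph X} {w x : X} (h : DTree Y G) (hw : w ∈ Y)
      (hx : x ∉ Y) : DTree (insert x Y) (outArc w x + G)
  | inn {Y : Finset X} {G : OGraph X} {w x : X} (h : DTree Y G) (hw : w ∈ Y)
      (hx : x ∉ Y) : DTree (insert x Y) (outArc x w + G)

theorem RootedTree.dtree {Y : Finset X} {r : X} {G : OGraph X} (h : RootedTree Y r G) :
    DTree Y G := by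
  induction h with
  | point r => exact .point r
  | graft _ hw hx ih => exact .out ih hw hx

theorem RootedTree.root_mem {Y : Finset X} {r : X} {G : OGraph X} (h : RootedTree Y r G) :
    r ∈ Y := by
  induction h with
  | point r => simp
  | graft _ hw hx ih => simp [ih]

theorem DTree.congr {Y Y' : Finset X} {G G' : OGraph X} (h : DTree Y G) (hY : Y = Y')
    (hG : G = G') : DTree Y' G' := by subst hY hG; exact h

theorem RootedTree.congr {Y Y' : Finset X} {r : X} {G G' : OGraph X} (h : RootedTree Y r G)
    (hY : Y = Y') (hG : G = G') : RootedTree Y' r G' := by subst hY hG; exact h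

/-- Two directed trees on disjoint vertex sets joined by an arc form a directed tree. -/
theorem DTree.join {B : Finset X} {T : OGraph X} (hT : DTree B T) :
    ∀ {A : Finset X} {S : OGraph X} {a b : X}, DTree A S → Disjoint A B → a ∈ A → b ∈ B →
      DTree (A ∪ B) (outArc a b + S + T) ∧ DTree (A ∪ B) (outArc b a + S + T) := by
  induction hT with
  | point r =>
    intro A S a b hS hd ha hb
    obtain rfl := Finset.mem_singleton.mp hb
    have hb' : b ∉ A := fun h => Finset.disjoint_left.mp hd h (by simp)
    exact ⟨(hS.out ha hb').congr (by ext; simp) (by simp),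
      (hS.inn ha hb').congr (by ext; simp) (by simp)⟩
  | @out B T w x hT hw hx ih =>
    intro A S a b hS hd ha hb
    rw [Finset.disjoint_insert_right] at hd
    -- If the junction is the letter attached last, that letter is moved over to `A` and its former
    -- arc becomes the joining arc. Otherwise it is attached again after joining.
    by_cases hbx : b = x
    · subst hbx
      have hd' : Disjoint (insert b A) B := Finset.disjoint_insert_left.mpr ⟨hx, hd.2⟩
      have h1 := (ih (hS.out ha hd.1) hd' (Finset.mem_insert_self _ _) hw).2
      have h2 := (ih (hS.inn ha hd.1) hd' (Finset.mem_insert_self _ _) hw).2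
      exact ⟨h1.congr (by ext; simp) (by abel), h2.congr (by ext; simp) (by abel)⟩
    · have hb' : b ∈ B := by simpa [hbx] using hb
      obtain ⟨h1, h2⟩ := ih hS hd.2 ha hb'
      have hxn : x ∉ A ∪ B := by simp [hd.1, hx]
      have hwn : w ∈ A ∪ B := by simp [hw]
      exact ⟨(h1.out hwn hxn).congr (by ext; simp) (by abel),
        (h2.out hwn hxn).congr (by ext; simp) (by abel)⟩
  | @inn B T w x hT hw hx ih =>
    intro A S a b hS hd ha hb
    rw [Finset.disjoint_insert_right] at hd
    by_cases hbx : b = x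
    · subst hbx
      have hd' : Disjoint (insert b A) B := Finset.disjoint_insert_left.mpr ⟨hx, hd.2⟩
      have h1 := (ih (hS.out ha hd.1) hd' (Finset.mem_insert_self _ _) hw).1
      have h2 := (ih (hS.inn ha hd.1) hd' (Finset.mem_insert_self _ _) hw).1
      exact ⟨h1.congr (by ext; simp) (by abel), h2.congr (by ext; simp) (by abel)⟩
    · have hb' : b ∈ B := by simpa [hbx] using hb
      obtain ⟨h1, h2⟩ := ih hS hd.2 ha hb'
      have hxn : x ∉ A ∪ B := by simp [hd.1, hx]
      have hwn : w ∈ A ∪ B := by simp [hw]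
      exact ⟨(h1.inn hwn hxn).congr (by ext; simp) (by abel),
        (h2.inn hwn hxn).congr (by ext; simp) (by abel)⟩

/-- The directed path `tₘ ← ⋯ ← t₁` given by the list `[tₘ, …, t₁]`. -/
def chainUp : List X → OGraph X
  | [] => 0
  | [_] => 0
  | x :: y :: l => outArc y x + chainUp (y :: l)

theorem chainUp_dtree : ∀ {l : List X}, l.Nodup → l ≠ [] → DTree l.toFinset (chainUp l)
  | [], _, h => absurd rfl h
  | [x], _, _ => by simpa [chainUp] using DTree.point x
  | x :: y :: l, hn, _ => by
    have ih := chainUp_dtree (l := y :: l) (List.nodup_cons.mp hn).2 (by simp)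
    have hx : x ∉ (y :: l).toFinset := by
      simpa using (List.nodup_cons.mp hn).1
    exact (ih.out (w := y) (by simp) hx).congr (by simp) rfl

theorem chainUp_rooted : ∀ {l : List X}, l.Nodup → l ≠ [] →
    ∃ r, RootedTree l.toFinset r (chainUp l)
  | [], _, h => absurd rfl h
  | [x], _, _ => ⟨x, by simpa [chainUp] using RootedTree.point x⟩
  | x :: y :: l, hn, _ => by
    obtain ⟨r, ih⟩ := chainUp_rooted (l := y :: l) (List.nodup_cons.mp hn).2 (by simp)
    have hx : x ∉ (y :: l).toFinset := by
      simpa using (List.nodup_cons.mp hn).1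
    exact ⟨r, (ih.graft (w := y) (by simp) hx).congr (by simp) rfl⟩

/-! ### Local relations -/

variable (R X) in
/-- The submodule generated by the relations that are stable under adding arcs. -/
noncomputable def localRelations : Submodule R (Gam R X) :=
  Submodule.span R (symmetryCombinations R X ∪ jacobiCombinations R X ∪
    mixedJacobiCombinations R X ∪ multipleEdgeGraphs R X)

variable (R) in
/-- Adding the arcs of `H` to all graphs. -/
noncomputable def addArcs (H : OGraph X) : Gam R X →ₗ[R] Gam R X :=
  Finsupp.lmapDomain R R (fun G => H + G)

omit [LinearOrder X] in
@[simp] theorem addArcs_single (H G : OGraph X) : addArcs R H (single R G) = single R (H + G) := by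
  simp [addArcs, single, Finsupp.mapDomain_single]

-- Disconnected graphs are left out of `localRelations` because added arcs may connect them. The
-- other relations have an arbitrary surrounding graph, which absorbs `H`.
omit [LinearOrder X] in
theorem addArcs_mem (H : OGraph X) {x : Gam R X} (hx : x ∈ localRelations R X) :
    addArcs R H x ∈ localRelations R X := by
  suffices h : localRelations R X ≤ (localRelations R X).comap (addArcs R H) from h hx
  refine Submodule.span_le.mpr ?_
  rintro x (((⟨K, a, rfl⟩ | ⟨K, i, j, k, hij, hjk, hki, c, rfl⟩) |
    ⟨K, i, j, k, hij, hjk, hki, rfl⟩) | ⟨K, a, b, hab, rfl⟩)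
  all_goals
    refine Submodule.subset_span ?_
    simp only [map_add, addArcs_single, Multiset.add_cons]
  · exact Or.inl (Or.inl (Or.inl ⟨H + K, a, rfl⟩))
  · exact Or.inl (Or.inl (Or.inr ⟨H + K, i, j, k, hij, hjk, hki, c, rfl⟩))
  · exact Or.inl (Or.inr ⟨H + K, i, j, k, hij, hjk, hki, rfl⟩)
  · exact Or.inr ⟨H + K, a, b, hab, rfl⟩

omit [LinearOrder X] in
theorem localRelations_le : localRelations R X ≤ relations R X :=
  Submodule.span_mono Set.subset_union_left

section Rules

variable {S : Submodule R (Gam R X)} (hS : localRelations R X ≤ S)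

include hS

omit [LinearOrder X] in
theorem mem_reverse {a : Arc X} {H : OGraph X} (h : single R (a ::ₘ H) ∈ S) :
    single R (a.reverse ::ₘ H) ∈ S := by
  have : single R (a ::ₘ H) + single R (a.reverse ::ₘ H) ∈ S :=
    hS (Submodule.subset_span (Or.inl (Or.inl (Or.inl ⟨H, a, rfl⟩))))
  exact (Submodule.add_mem_iff_right _ h).mp this

theorem mem_carc_comm {c : EdgeColor} {u v : X} {H : OGraph X} :
    single R (carc c u v + H) ∈ S ↔ single R (carc c v u + H) ∈ S := by
  by_cases h : u = v
  · subst h; rfl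
  · rw [carc_of_ne h, carc_of_ne (Ne.symm h), Multiset.singleton_add, Multiset.singleton_add]
    exact ⟨fun h' => mem_reverse hS h', fun h' => mem_reverse hS h'⟩

theorem mem_carc_comm₂ {A : OGraph X} {c : EdgeColor} {u v : X} {H : OGraph X} :
    single R (A + carc c u v + H) ∈ S ↔ single R (A + carc c v u + H) ∈ S := by
  rw [add_comm A, add_comm A, add_assoc, add_assoc]
  exact mem_carc_comm hS

theorem mem_jacobi {c : EdgeColor} {i j k : X} (hij : i ≠ j) (hjk : j ≠ k) (hki : k ≠ i)
    {H : OGraph X} (h2 : single R (carc c j k + carc c k i + H) ∈ S)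
    (h3 : single R (carc c k i + carc c i j + H) ∈ S) :
    single R (carc c i j + carc c j k + H) ∈ S := by
  simp only [carc_of_ne hij, carc_of_ne hjk, carc_of_ne hki, Multiset.singleton_add,
    Multiset.cons_add]
    at h2 h3 ⊢
  have h := hS (Submodule.subset_span (Or.inl (Or.inl (Or.inr ⟨H, i, j, k, hij, hjk, hki, c, rfl⟩))))
  exact (Submodule.add_mem_iff_left _ h2).mp ((Submodule.add_mem_iff_left _ h3).mp h)

/-- The mixed relation is unchanged when red and blue are exchanged, so one form covers both choices
of `c`. -/
theorem mem_mixed {i j k : X} (hij : i ≠ j) (hjk : j ≠ k) (hki : k ≠ i) {c d : EdgeColor}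
    (hcd : c ≠ d) {H : OGraph X}
    (h2 : single R (carc c j k + carc d k i + H) ∈ S)
    (h3 : single R (carc c k i + carc d i j + H) ∈ S)
    (h4 : single R (carc d i j + carc c j k + H) ∈ S)
    (h5 : single R (carc d j k + carc c k i + H) ∈ S)
    (h6 : single R (carc d k i + carc c i j + H) ∈ S) :
    single R (carc c i j + carc d j k + H) ∈ S := by
  simp only [carc_of_ne hij, carc_of_ne hjk, carc_of_ne hki, Multiset.singleton_add,
    Multiset.cons_add]
    at h2 h3 h4 h5 h6 ⊢
  have h := hS (Submodule.subset_span (Or.inl (Or.inr ⟨H, i, j, k, hij, hjk, hki, rfl⟩)))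
  cases c <;> cases d <;> simp only [ne_eq, not_true_eq_false] at hcd
  · have := (Submodule.add_mem_iff_right _ (S.add_mem (S.add_mem h4 h5) h6)).mp h
    exact (Submodule.add_mem_iff_left _ h2).mp ((Submodule.add_mem_iff_left _ h3).mp this)
  · have := (Submodule.add_mem_iff_left _ (S.add_mem (S.add_mem h4 h5) h6)).mp h
    exact (Submodule.add_mem_iff_left _ h2).mp ((Submodule.add_mem_iff_left _ h3).mp this)

/-- Two arcs into `j` coming from the same side, the one from `i` being the longer one. -/
theorem mem_same {i k j : X} (h : i < k ∧ k < j ∨ j < k ∧ k < i) {H : OGraph X}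
    (h1 : single R (outArc i k + outArc k j + H) ∈ S)
    (h2 : single R (outArc i j + outArc i k + H) ∈ S) :
    single R (outArc i j + outArc k j + H) ∈ S := by
  have hne : i ≠ j ∧ j ≠ k ∧ k ≠ i := by
    rcases h with h | h
    · exact ⟨(h.1.trans h.2).ne, h.2.ne', h.1.ne'⟩
    · exact ⟨(h.1.trans h.2).ne', h.1.ne, h.2.ne⟩
  -- Along the monotone triple `i`, `k`, `j` all three arcs have the same colour, so the ordinary
  -- Jacobi relation links them.
  obtain ⟨c, e1, e2, e3⟩ : ∃ c, colorOf i k = c ∧ colorOf k j = c ∧ colorOf i j = c := by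
    rcases h with h | h
    · exact ⟨_, colorOf_red h.1, colorOf_red h.2, colorOf_red (h.1.trans h.2)⟩
    · exact ⟨_, colorOf_blue h.2, colorOf_blue h.1, colorOf_blue (h.1.trans h.2)⟩
  simp only [outArc, e1, e2, e3] at h1 h2 ⊢
  rw [mem_carc_comm₂ hS]
  refine mem_jacobi hS hne.1 hne.2.1 hne.2.2 ?_ ?_
  · rw [mem_carc_comm₂ hS, add_comm (carc c j k), mem_carc_comm₂ hS]
    exact h1
  · rw [add_comm (carc c k i), mem_carc_comm₂ hS]
    exact h2

/-- Two arcs into `j` coming from different sides. -/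
theorem mem_opposite {i k j : X} (h : i < j ∧ j < k ∨ k < j ∧ j < i) {H : OGraph X}
    (h1 : single R (outArc j i + outArc j k + H) ∈ S)
    (h2 : single R (outArc j k + outArc k i + H) ∈ S)
    (h3 : single R (outArc i k + outArc k j + H) ∈ S)
    (h4 : single R (outArc k i + outArc i j + H) ∈ S)
    (h5 : single R (outArc j i + outArc i k + H) ∈ S) :
    single R (outArc i j + outArc k j + H) ∈ S := by
  have hne : i ≠ j ∧ j ≠ k ∧ k ≠ i := by
    rcases h with h | h
    · exact ⟨h.1.ne, h.2.ne, (h.1.trans h.2).ne'⟩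
    · exact ⟨h.2.ne', h.1.ne', (h.1.trans h.2).ne⟩
  -- Each side of the triangle occurs in both colours in the mixed relation, and its colour decides
  -- which direction is consistent. Up to sign, the five other terms are therefore the consistent
  -- graphs of `h1` to `h5`.
  obtain ⟨c, d, hcd, e1, e2, e3, e4, e5, e6⟩ : ∃ c d, c ≠ d ∧ colorOf i j = c ∧ colorOf k j = d ∧
      colorOf j k = c ∧ colorOf j i = d ∧ colorOf i k = c ∧ colorOf k i = d := by
    rcases h with h | h
    · exact ⟨.red, .blue, by simp, colorOf_red h.1, colorOf_blue h.2, colorOf_red h.2,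
        colorOf_blue h.1, colorOf_red (h.1.trans h.2), colorOf_blue (h.1.trans h.2)⟩
    · exact ⟨.blue, .red, by simp, colorOf_blue h.2, colorOf_red h.1, colorOf_blue h.1,
        colorOf_red h.2, colorOf_blue (h.1.trans h.2), colorOf_red (h.1.trans h.2)⟩
  simp only [outArc, e1, e2, e3, e4, e5, e6] at h1 h2 h3 h4 h5 ⊢
  rw [mem_carc_comm₂ hS]
  refine mem_mixed hS hne.1 hne.2.1 hne.2.2 hcd ?_ ?_ ?_ ?_ ?_
  · exact h2
  · rw [mem_carc_comm₂ hS, add_comm (carc c k i), mem_carc_comm₂ hS]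
    exact h5
  · rw [add_comm (carc d i j), mem_carc_comm₂ hS, add_comm (carc c j k)]
    exact h1
  · rw [mem_carc_comm₂ hS, add_comm (carc d j k), mem_carc_comm₂ hS]
    exact h3
  · exact h4

end Rules
end EilTwo

/-! ### Generation by rooted trees -/

namespace EilTwo

variable {R : Type*} [CommRing R] {X : Type*} [LinearOrder X]

/-! ### Trees are combinations of rooted trees -/

variable (R) in
/-- Combinations of rooted trees on `Y`, up to local relations. -/
noncomputable def rootedSpan (Y : Finset X) : Submodule R (Gam R X) :=
  localRelations R X ⊔ Submodule.span R {x | ∃ r G, RootedTree Y r G ∧ x = single R G}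

theorem localRelations_le_rootedSpan (Y : Finset X) : localRelations R X ≤ rootedSpan R Y :=
  le_sup_left

theorem RootedTree.mem_rootedSpan {Y : Finset X} {r : X} {G : OGraph X} (h : RootedTree Y r G) :
    single R G ∈ rootedSpan R Y :=
  Submodule.mem_sup_right (Submodule.subset_span ⟨r, G, h, rfl⟩)

/-- Reduction principle: a subgraph known to be a combination of rooted trees may be assumed to be a
rooted tree inside a larger graph, since local relations survive the addition of arcs. -/
theorem addArcs_mem_of_rootedSpan {Y : Finset X} {S : Submodule R (Gam R X)}
    (hS : localRelations R X ≤ S) {H : OGraph X}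
    (h : ∀ r G, RootedTree Y r G → single R (H + G) ∈ S) {x : Gam R X}
    (hx : x ∈ rootedSpan R Y) : addArcs R H x ∈ S := by
  suffices h : rootedSpan R Y ≤ S.comap (addArcs R H) from h hx
  refine sup_le (fun x hx => hS (addArcs_mem H hx)) (Submodule.span_le.mpr ?_)
  rintro x ⟨r, G, hG, rfl⟩
  simpa using h r G hG

omit [LinearOrder X] in
theorem mem_congr {S : Submodule R (Gam R X)} {G G' : OGraph X} (h : single R G ∈ S) (e : G = G') :
    single R G' ∈ S := e ▸ h

section Reduction

variable {Y : Finset X}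
  (ih : ∀ Z : Finset X, Z.card < Y.card → ∀ G, DTree Z G → single R G ∈ rootedSpan R Z)

include ih

/-- Trees with a leaf whose arc points to the leaf. -/
theorem mem_of_sink {Z : Finset X} {G : OGraph X} {w x : X} (hG : DTree Z G) (hw : w ∈ Z)
    (hx : x ∉ Z) (hY : insert x Z = Y) : single R (outArc w x + G) ∈ rootedSpan R Y := by
  subst hY
  have h := ih Z (by simp [hx]) G hG
  rw [← addArcs_single]
  exact addArcs_mem_of_rootedSpan (localRelations_le_rootedSpan _)
    (fun r T hT => (hT.graft hw hx).mem_rootedSpan) h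

/-- Trees with a vertex `x` with exactly two arcs, both of them pointing to `x` and coming from the
same side. -/
theorem mem_of_same {Z : Finset X} {H : OGraph X} {i k x : X}
    (h1 : DTree Z (outArc i k + H)) (h2 : DTree Z (outArc k i + H))
    (hi : i ∈ Z) (hk : k ∈ Z) (hx : x ∉ Z) (hik : i ≠ k) (hY : insert x Z = Y)
    (hs : i < x ∧ k < x ∨ x < i ∧ x < k) :
    single R (outArc i x + outArc k x + H) ∈ rootedSpan R Y := by
  have hS := localRelations_le_rootedSpan (R := R) Y
  have a1 := mem_of_sink (R := R) ih h1 hk hx hY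
  have a2 := mem_of_sink (R := R) ih h1 hi hx hY
  have b1 := mem_of_sink (R := R) ih h2 hk hx hY
  have b2 := mem_of_sink (R := R) ih h2 hi hx hY
  -- The source farther from `x` takes the role of `i` in `mem_same`. In both resulting terms `x` is
  -- a leaf entered by its only arc.
  by_cases hf : i < k ∧ k < x ∨ x < k ∧ k < i
  · refine mem_same hS hf ?_ ?_
    · exact mem_congr a1 (by abel)
    · exact mem_congr a2 (by abel)
  · rw [add_comm (outArc i x)]
    have hf' : k < i ∧ i < x ∨ x < i ∧ i < k := by
      rcases hs with hs | hs <;> rcases hik.lt_or_gt with h | h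
      · exact absurd (Or.inl ⟨h, hs.2⟩) hf
      · exact Or.inl ⟨h, hs.1⟩
      · exact Or.inr ⟨hs.1, h⟩
      · exact absurd (Or.inr ⟨hs.2, h⟩) hf
    refine mem_same hS hf' ?_ ?_
    · exact mem_congr b2 (by abel)
    · exact mem_congr b1 (by abel)

/-- A path `h ← ⋯` with a further arc into its end `h`. -/
theorem mem_of_chain {Z : Finset X} {G : OGraph X} (hG : DTree Z G) {p h : X} {l : List X}
    (hp : p ∈ Z) (hl : (h :: l).Nodup) (hd : Disjoint Z (h :: l).toFinset)
    (hY : Z ∪ (h :: l).toFinset = Y)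
    (hs : ∀ z ∈ l.head?, p < h ∧ z < h ∨ h < p ∧ h < z) :
    single R (outArc p h + G + chainUp (h :: l)) ∈ rootedSpan R Y := by
  cases l with
  | nil =>
    simp only [chainUp, add_zero]
    refine mem_of_sink ih hG hp (fun hz => Finset.disjoint_left.mp hd hz (by simp)) ?_
    rw [← hY]; ext; simp
  | cons y l =>
    have hn := List.nodup_cons.mp hl
    rw [List.toFinset_cons, Finset.disjoint_insert_right] at hd
    have hj := (chainUp_dtree hn.2 (by simp)).join hG hd.2 hp (b := y) (by simp)
    have hpy : p ≠ y := by
      rintro rfl; exact Finset.disjoint_left.mp hd.2 hp (by simp)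
    have := mem_of_same (R := R) (x := h) (Y := Y) ih (hj.1.congr rfl (add_assoc _ _ _))
      (hj.2.congr rfl (add_assoc _ _ _)) (by simp [hp]) (by simp)
      (by simpa [hd.1] using hn.1) hpy
      (by rw [← hY]; ext; simp) (hs y (by simp))
    exact mem_congr this (by simp only [chainUp]; abel)

/-- `ρ` is one of the relations `<` and `>`. -/
theorem mem_of_push {ρ : X → X → Prop} (hρ : ρ = (· < ·) ∨ ρ = (· > ·)) {u : X} :
    ∀ (l : List X) (h : X) {V : Finset X} {K : OGraph X}, DTree V K → h ∈ V → u ∉ V →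
      (h :: l).Pairwise (fun a b => ρ b a) → (∀ t ∈ h :: l, ρ u t) →
      (∀ t ∈ l, t ∉ V) → V ∪ insert u l.toFinset = Y →
      single R (K + chainUp (h :: l ++ [u])) ∈ rootedSpan R Y →
      single R (K + outArc u h + chainUp (h :: l)) ∈ rootedSpan R Y := by
  intro l
  have hirr : ∀ a, ¬ ρ a a := by rcases hρ with rfl | rfl <;> simp
  have hn' : ∀ {m : List X}, m.Pairwise (fun a b => ρ b a) → m.Nodup := fun hm =>
    hm.imp (by rintro a b hab rfl; exact hirr _ hab)
  induction l with
  | nil =>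
    intro h V K hK hh hu _ _ _ _ hm
    simpa [chainUp] using hm
  | cons y l ihl =>
    intro h V K hK hh hu hp hlt hdis hY hm
    have hp' := List.pairwise_cons.mp hp
    have hyV : y ∉ V := hdis y (by simp)
    have hyu : u ≠ y := by rintro rfl; exact hirr _ (hlt u (by simp))
    have hlu : ∀ t ∈ l, t ≠ u := by rintro t ht rfl; exact hirr _ (hlt t (by simp [ht]))
    have hly : ∀ t ∈ l, t ≠ y := by
      rintro t ht rfl; exact (List.nodup_cons.mp (hn' hp'.2)).1 ht
    -- Jacobi on `u`, `y`, `h` trades the arc from `u` into `h` for one into the next letter `y` of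
    -- the path (`h1`, by induction), at the cost of a graph where `u` points to both `h` and `y`
    -- (`h2`, by `mem_of_chain`).
    have h1 := ihl y (hK.inn hh hyV) (by simp) (by simp [hu, hyu]) hp'.2
      (fun t ht => hlt t (List.mem_cons_of_mem _ ht))
      (fun t ht => by simp [hdis t (List.mem_cons_of_mem _ ht), hly t ht])
      (by rw [← hY]; ext; simp)
      (mem_congr hm (by simp only [List.cons_append, chainUp]; abel))
    have h2 := mem_of_chain (R := R) (Y := Y) ih (hK.inn hh hu) (p := u) (h := y) (l := l)
      (by simp) (hn' hp'.2)
      (by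
        rw [Finset.disjoint_right]
        intro t ht
        simp only [List.toFinset_cons, Finset.mem_insert, List.mem_toFinset] at ht
        rcases ht with rfl | ht
        · simp [hyV, hyu.symm]
        · simp [hdis t (List.mem_cons_of_mem _ ht), hlu t ht])
      (by rw [← hY]; ext; simp [or_left_comm])
      (by
        intro z hz
        have hz' : z ∈ l := List.mem_of_mem_head? hz
        have e1 := (List.pairwise_cons.mp hp'.2).1 z hz'
        have e2 := hlt y (by simp)
        rcases hρ with rfl | rfl
        · exact Or.inl ⟨e2, e1⟩
        · exact Or.inr ⟨e2, e1⟩)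
    have hf : u < y ∧ y < h ∨ h < y ∧ y < u := by
      have e1 := hp'.1 y (by simp)
      have e2 := hlt y (by simp)
      rcases hρ with rfl | rfl
      · exact Or.inl ⟨e2, e1⟩
      · exact Or.inr ⟨e1, e2⟩
    have h3 := mem_same (localRelations_le_rootedSpan (R := R) Y) hf (H := K + chainUp (y :: l))
      (mem_congr h1 (by abel)) (mem_congr h2 (by abel))
    exact mem_congr h3 (by simp only [chainUp]; abel)

/-- A rooted tree and a monotone path `tₘ ← ⋯ ← t₁` joined by an arc from `tₘ` to a vertex
`u`. -/
theorem mem_of_rooted_chain {ρ : X → X → Prop} (hρ : ρ = (· < ·) ∨ ρ = (· > ·)) {Z : Finset X}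
    {r : X} {G : OGraph X} (hG : RootedTree Z r G) :
    ∀ {u h : X} {l : List X}, u ∈ Z → (h :: l).Pairwise (fun a b => ρ b a) →
      (∀ t ∈ h :: l, ρ u t) → (∀ t ∈ h :: l, t ∉ Z) → Z ∪ (h :: l).toFinset = Y →
      single R (outArc h u + G + chainUp (h :: l)) ∈ rootedSpan R Y := by
  have hirr : ∀ a, ¬ ρ a a := by rcases hρ with rfl | rfl <;> simp
  have htr : ∀ {a b c}, ρ a b → ρ b c → ρ a c := by
    rcases hρ with rfl | rfl
    · exact fun h1 h2 => lt_trans h1 h2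
    · exact fun h1 h2 => gt_trans h1 h2
  have hn' : ∀ {m : List X}, m.Pairwise (fun a b => ρ b a) → m.Nodup := fun hm =>
    hm.imp (by rintro a b hab rfl; exact hirr _ hab)
  -- The induction follows the construction of the rooted tree, with `u` and the path left general:
  -- when the letter grafted last is `u`, the path absorbs `u` and is reattached at the parent of
  -- `u`.
  induction hG with
  | point r =>
    intro u h l hu hp hlt hdis hY
    obtain rfl := Finset.mem_singleton.mp hu
    have hnd : (u :: h :: l).Nodup :=
      List.nodup_cons.mpr ⟨fun hh => hdis u hh (by simp), hn' hp⟩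
    obtain ⟨r, hr⟩ := chainUp_rooted hnd (by simp)
    have := (hr.congr (Y' := Y) (by rw [← hY]; ext; simp [or_left_comm]) rfl).mem_rootedSpan (R := R)
    simpa [chainUp] using this
  | @graft Z r G w x hG hw hx ihG =>
    intro u h l hu hp hlt hdis hY
    have hnd := hn' hp
    have hdZ : ∀ t ∈ h :: l, t ∉ Z := fun t ht hz => hdis t ht (by simp [hz])
    have hdx : ∀ t ∈ h :: l, t ≠ x := fun t ht hz => hdis t ht (by simp [hz])
    have hdj : Disjoint Z (h :: l).toFinset :=
      Finset.disjoint_right.mpr fun t ht => hdZ t (List.mem_toFinset.mp ht)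
    have hch := chainUp_dtree hnd (by simp)
    have hxl : x ∉ (h :: l).toFinset := fun hh => hdx x (List.mem_toFinset.mp hh) rfl
    have hxU : x ∉ Z ∪ (h :: l).toFinset := by
      rw [Finset.mem_union]; exact fun hh => hh.elim hx hxl
    have hYU : insert x (Z ∪ (h :: l).toFinset) = Y := by rw [← hY, Finset.insert_union]
    by_cases hux : u = x
    swap
    · have huZ : u ∈ Z := by simpa [hux] using hu
      have hj := (hch.join hG.dtree hdj huZ (b := h) (by simp)).2
      have := mem_of_sink (R := R) ih hj (w := w) (by simp [hw]) hxU hYU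
      exact mem_congr this (by abel)
    subst hux
    have hj := hch.join hG.dtree hdj hw (b := h) (by simp)
    have hwU : w ∈ Z ∪ (h :: l).toFinset := by simp [hw]
    have hhU : h ∈ Z ∪ (h :: l).toFinset := by simp
    have hwu : w ≠ u := by rintro rfl; exact hx hw
    have hwh : w ≠ h := by rintro rfl; exact hdZ w (by simp) hw
    have huh : ρ u h := hlt h (by simp)
    -- Two arcs enter `u`, from `w` and from `h`. If `w` and `h` lie on the same side, Jacobi
    -- suffices. Otherwise `u` lies between them, and `g1` to `g5` are the other terms of the mixed
    -- relation.
    by_cases hρw : ρ w u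
    swap
    · have hs : w < u ∧ h < u ∨ u < w ∧ u < h := by
        rcases hρ with rfl | rfl
        · exact Or.inr ⟨lt_of_le_of_ne (not_lt.mp hρw) hwu.symm, huh⟩
        · exact Or.inl ⟨lt_of_le_of_ne (not_lt.mp hρw) hwu, huh⟩
      have := mem_of_same (R := R) ih (hj.1.congr rfl (add_assoc _ _ _))
        (hj.2.congr rfl (add_assoc _ _ _)) hwU hhU hxU hwh hYU hs
      exact mem_congr this (by abel)
    have hm : w < u ∧ u < h ∨ h < u ∧ u < w := by
      rcases hρ with rfl | rfl
      · exact Or.inl ⟨hρw, huh⟩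
      · exact Or.inr ⟨huh, hρw⟩
    have hchain : ∀ p ∈ insert u Z, ρ p h → (∀ z ∈ h :: l, ρ p z) →
        single R (outArc p h + (outArc u w + G) + chainUp (h :: l)) ∈ rootedSpan R Y := by
      intro p hpZ hph _
      refine mem_of_chain ih (hG.dtree.inn hw hx) hpZ hnd
        (Finset.disjoint_right.mpr fun t ht => hdis t (List.mem_toFinset.mp ht)) hY ?_
      intro z hz
      have e1 := (List.pairwise_cons.mp hp).1 z (List.mem_of_mem_head? hz)
      rcases hρ with rfl | rfl
      · exact Or.inl ⟨hph, e1⟩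
      · exact Or.inr ⟨hph, e1⟩
    have g1 := hchain u (by simp) huh hlt
    have g5 := hchain w (by simp [hw]) (htr hρw huh) fun z hz => htr hρw (hlt z hz)
    have g3 := mem_of_sink (R := R) ih hj.1 (w := h) hhU hxU hYU
    have g4 := mem_of_sink (R := R) ih hj.2 (w := w) hwU hxU hYU
    -- As `w` precedes `u` and `u` precedes the whole path with respect to `ρ`, the path extended by
    -- `u` is again monotone and lies beyond `w`. The induction hypothesis thus applies at `w`, and
    -- `mem_of_push` carries its result to `g2`.
    have hpw : (h :: l ++ [u]).Pairwise (fun a b => ρ b a) := by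
      rw [List.pairwise_append]
      refine ⟨hp, by simp, fun a ha b hb => ?_⟩
      rw [List.mem_singleton.mp hb]; exact hlt a ha
    have i2 := ihG (u := w) (h := h) (l := l ++ [u]) hw hpw
      (by
        intro t ht
        rw [← List.cons_append, List.mem_append, List.mem_singleton] at ht
        rcases ht with ht | rfl
        · exact htr hρw (hlt t ht)
        · exact hρw)
      (by
        intro t ht
        rw [← List.cons_append, List.mem_append, List.mem_singleton] at ht
        rcases ht with ht | rfl
        · exact hdZ t ht
        · exact hx)
      (by rw [← hY]; ext; simp [or_left_comm])
    have hhZ : h ∉ Z := hdZ h (by simp)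
    have g2 := mem_of_push (R := R) (Y := Y) ih hρ l h (hG.dtree.inn hw hhZ) (by simp)
      (by simp [hx, (hdx h (by simp)).symm]) hp hlt
      (fun t ht => by
        have : t ≠ h := by rintro rfl; exact (List.nodup_cons.mp hnd).1 ht
        simp [this, hdZ t (List.mem_cons_of_mem _ ht)])
      (by rw [← hY]; ext; simp [or_left_comm]) (mem_congr i2 rfl)
    have := mem_opposite (localRelations_le_rootedSpan (R := R) Y) hm (H := G + chainUp (h :: l))
      (mem_congr g1 (by abel)) (mem_congr g2 (by abel)) (mem_congr g3 (by abel))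
      (mem_congr g4 (by abel)) (mem_congr g5 (by abel))
    exact mem_congr this (by abel)

end Reduction

/-- Every tree of consistent arcs is a combination of rooted trees, up to local relations. -/
theorem DTree.mem_rootedSpan {Y : Finset X} {G : OGraph X} (hG : DTree Y G) :
    single R G ∈ rootedSpan R Y := by
  induction hc : Y.card using Nat.strong_induction_on generalizing Y G with
  | _ n ihn =>
    subst hc
    have ih : ∀ Z : Finset X, Z.card < Y.card → ∀ G, DTree Z G → single R G ∈ rootedSpan R Z :=
      fun Z hZ G hG => ihn _ hZ hG rfl
    cases hG with
    | point r => exact (RootedTree.point r).mem_rootedSpan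
    | out h hw hx => exact mem_of_sink ih h hw hx rfl
    | @inn Z G w x h hw hx =>
      rw [← addArcs_single]
      refine addArcs_mem_of_rootedSpan (localRelations_le_rootedSpan _) (fun r T hT => ?_)
        (ih Z (by simp [hx]) G h)
      -- The leaf `x` is a path with one letter; `ρ` records on which side of `w` it lies.
      have key : ∀ ρ : X → X → Prop, (ρ = (· < ·) ∨ ρ = (· > ·)) → ρ w x →
          single R (outArc x w + T) ∈ rootedSpan R (insert x Z) := by
        intro ρ hρ hwx
        have := mem_of_rooted_chain (R := R) ih hρ hT (u := w) (h := x) (l := []) hw (by simp)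
          (by simpa using hwx) (by simpa using hx) (by ext; simp)
        simpa [chainUp] using this
      rcases lt_trichotomy w x with h | rfl | h
      · exact key _ (Or.inl rfl) h
      · exact absurd hw hx
      · exact key _ (Or.inr rfl) h

end EilTwo

namespace EilTwo

variable {R : Type*} [CommRing R] {X : Type*} [LinearOrder X]

/-! ### Graphs with cycles -/

/-- The arc `a` joins `u` and `v`, in one of the two directions. -/
def Arc.Joins (a : Arc X) (u v : X) : Prop := (a.src = u ∧ a.tgt = v) ∨ (a.src = v ∧ a.tgt = u)

omit [LinearOrder X] in
theorem Arc.Joins.symm {a : Arc X} {u v : X} (h : a.Joins u v) : a.Joins v u := Or.symm h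

omit [LinearOrder X] in
theorem Arc.Joins.ne {a : Arc X} {u v : X} (h : a.Joins u v) : u ≠ v := by
  rcases h with ⟨rfl, rfl⟩ | ⟨rfl, rfl⟩
  · exact a.ne
  · exact a.ne.symm

/-- `P` consists of the arcs of a walk of length `m` from `u` to `v`. -/
inductive ArcWalk : ℕ → X → X → OGraph X → Prop
  | nil (u : X) : ArcWalk 0 u u 0
  | cons {m : ℕ} {u w v : X} {P : OGraph X} (a : Arc X) (ha : a.Joins u w) (h : ArcWalk m w v P) :
      ArcWalk (m + 1) u v ({a} + P)

omit [LinearOrder X] in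
theorem ArcWalk.snoc {m : ℕ} {u w v : X} {P : OGraph X} (h : ArcWalk m u w P) {a : Arc X}
    (ha : a.Joins w v) : ArcWalk (m + 1) u v ({a} + P) := by
  induction h with
  | nil u => exact .cons a ha (.nil v)
  | cons b hb _ ih =>
    have := ArcWalk.cons b hb (ih ha)
    rwa [add_left_comm] at this

section Cycle

variable {S : Submodule R (Gam R X)} (hS : localRelations R X ≤ S)

include hS

theorem mem_joins {a : Arc X} {u v : X} (ha : a.Joins u v) {H : OGraph X} :
    single R ({a} + H) ∈ S ↔ single R (carc a.color u v + H) ∈ S := by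
  rcases a with ⟨s, t, hst, c⟩
  rcases ha with ⟨h1, h2⟩ | ⟨h1, h2⟩ <;> simp only at h1 h2 <;> subst h1 h2
  · rw [carc_of_ne hst]
  · rw [mem_carc_comm hS, carc_of_ne hst]

theorem mem_parallel {c d : EdgeColor} {u v : X} (h : u ≠ v) {H : OGraph X} :
    single R (carc c u v + carc d v u + H) ∈ S := by
  rw [carc_of_ne h, carc_of_ne h.symm]
  simp only [Multiset.singleton_add, Multiset.cons_add]
  exact hS (Submodule.subset_span (Or.inr ⟨H, _, _, Or.inr ⟨rfl, rfl⟩, rfl⟩))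

/-- Graphs containing a cycle are local relations. -/
theorem mem_of_cycle (m : ℕ) : ∀ {u v : X} {P : OGraph X}, ArcWalk m u v P → u ≠ v →
    ∀ (c : EdgeColor) (H : OGraph X), single R (carc c v u + P + H) ∈ S := by
  induction m with
  | zero =>
    intro u v P hP huv
    cases hP; exact absurd rfl huv
  | succ m ih =>
    intro u v P hP huv c H
    cases hP with
    | @cons _ _ w _ P a ha hP =>
    -- two arcs of the same colour at `u`
    have key : ∀ {P : OGraph X}, ArcWalk m w v P → ∀ (c : EdgeColor) (H : OGraph X),
        single R (carc c v u + carc c u w + P + H) ∈ S := by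
      intro P hP c H
      by_cases hvw : v = w
      · subst hvw
        rw [add_assoc (carc c v u + carc c u v)]
        exact mem_parallel hS huv.symm
      rw [add_assoc (carc c v u + carc c u w)]
      -- Both other Jacobi terms contain an arc between `w` and `v`, which closes the shorter walk
      -- `P`.
      have h := fun H => ih hP (Ne.symm hvw) c H
      refine mem_jacobi hS huv.symm ha.ne (Ne.symm hvw) ?_ ?_
      · rw [mem_carc_comm₂ hS]
        exact mem_congr (h (carc c u w + H)) (by abel)
      · rw [add_comm (carc c w v), mem_carc_comm₂ hS]
        exact mem_congr (h (carc c v u + H)) (by abel)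
    suffices hs : single R (carc c v u + carc a.color u w + P + H) ∈ S by
      rw [add_assoc, add_left_comm, add_assoc, mem_joins hS ha]
      exact mem_congr hs (by abel)
    by_cases hca : c = a.color
    · rw [← hca]; exact key hP c H
    cases hP with
    | nil =>
      rw [add_zero]; exact mem_parallel hS huv.symm
    | @cons k _ x _ P b hb hP =>
    suffices hs : single R (carc a.color u w + carc b.color w x + (carc c v u + P + H)) ∈ S by
      have : single R ({b} + (carc a.color u w + (carc c v u + P + H))) ∈ S := by
        rw [mem_joins hS hb]
        exact mem_congr hs (by abel)
      exact mem_congr this (by abel)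
    by_cases hux : u = x
    · subst hux; exact mem_parallel hS ha.ne
    -- An arc between `u` and `x` bypasses `w` and gives a shorter walk from `u` to `v`, whatever
    -- its colour.
    have hx : ∀ (d : EdgeColor) (H' : OGraph X),
        single R (carc d x u + (carc c v u + P + H')) ∈ S := by
      intro d H'
      rw [mem_carc_comm hS]
      refine mem_congr (ih (.cons ⟨u, x, hux, d⟩ (Or.inl ⟨rfl, rfl⟩) hP) huv c H') ?_
      rw [carc_of_ne hux]; abel
    have h1 : ∀ (d e : EdgeColor), single R (carc d w x + carc e x u + (carc c v u + P + H)) ∈ S :=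
      fun d e => mem_congr (hx e (carc d w x + H)) (by abel)
    have h2 : ∀ (d e : EdgeColor), single R (carc d x u + carc e u w + (carc c v u + P + H)) ∈ S :=
      fun d e => mem_congr (hx d (carc e u w + H)) (by abel)
    by_cases hab : a.color = b.color
    · rw [← hab]
      exact mem_jacobi hS ha.ne hb.ne (Ne.symm hux) (h1 _ _) (h2 _ _)
    -- There are only two colours, so `b` has the colour of the closing arc. The one term of the
    -- mixed relation without a shortcut exchanges the colours of `a` and `b`; it has two arcs of
    -- colour `c` at `u`, as in `key`.
    have hbc : b.color = c := by
      revert hca hab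
      cases c <;> cases a.color <;> cases b.color <;> simp
    refine mem_mixed hS ha.ne hb.ne (Ne.symm hux) hab (h1 _ _) (h2 _ _) ?_ (h1 _ _) (h2 _ _)
    rw [hbc]
    refine mem_congr (key (.cons ⟨w, x, hb.ne, a.color⟩ (Or.inl ⟨rfl, rfl⟩) hP) c H) ?_
    rw [carc_of_ne hb.ne]; abel

end Cycle

/-! ### Spanning trees of connected graphs -/

/-- `G` is a tree on the vertex set `Y`. -/
inductive TreeOn : Finset X → OGraph X → Prop
  | point (r : X) : TreeOn {r} 0
  | leaf {Y : Finset X} {G : OGraph X} {w x : X} (h : TreeOn Y G) (hw : w ∈ Y) (hx : x ∉ Y)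
      (a : Arc X) (ha : a.Joins w x) : TreeOn (insert x Y) ({a} + G)

theorem TreeOn.mem {Y : Finset X} {G : OGraph X} (h : TreeOn Y G) :
    ∀ a ∈ G, a.src ∈ Y ∧ a.tgt ∈ Y := by
  induction h with
  | point r => simp
  | leaf h hw hx a ha ih =>
    intro b hb
    rw [Multiset.mem_add, Multiset.mem_singleton] at hb
    rcases hb with rfl | hb
    · rcases ha with ⟨rfl, rfl⟩ | ⟨rfl, rfl⟩ <;> simp [hw]
    · simp [ih b hb]

theorem TreeOn.nonempty {Y : Finset X} {G : OGraph X} (h : TreeOn Y G) : Y.Nonempty := by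
  cases h <;> simp

theorem TreeOn.exists_walk {Y : Finset X} {G : OGraph X} (h : TreeOn Y G) :
    ∀ {u v : X}, u ∈ Y → v ∈ Y → ∃ m P Q, ArcWalk m u v P ∧ G = P + Q := by
  induction h with
  | point r =>
    intro u v hu hv
    obtain rfl := Finset.mem_singleton.mp hu
    obtain rfl := Finset.mem_singleton.mp hv
    exact ⟨0, 0, 0, .nil _, by simp⟩
  | @leaf Y G w x h hw hx a ha ih =>
    intro u v hu hv
    by_cases hux : u = x
    · subst hux
      by_cases hvx : v = u
      · subst hvx
        exact ⟨0, 0, _, .nil _, (zero_add _).symm⟩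
      · obtain ⟨m, P, Q, hP, rfl⟩ := ih hw (by simpa [hvx] using hv)
        exact ⟨_, _, Q, hP.cons a ha.symm, by abel⟩
    · have hu' : u ∈ Y := by simpa [hux] using hu
      by_cases hvx : v = x
      · subst hvx
        obtain ⟨m, P, Q, hP, rfl⟩ := ih hu' hw
        exact ⟨_, _, Q, hP.snoc ha, by abel⟩
      · obtain ⟨m, P, Q, hP, rfl⟩ := ih hu' (by simpa [hvx] using hv)
        exact ⟨m, P, _ + Q, hP, by rw [add_left_comm]⟩

omit [LinearOrder X] in
theorem OGraph.adj_iff {G : OGraph X} {u v : X} :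
    G.toSimpleGraph.Adj u v ↔ ∃ a ∈ G, a.Joins u v := by
  simp only [OGraph.toSimpleGraph, SimpleGraph.fromRel_adj, Arc.Joins]
  constructor
  · rintro ⟨-, ⟨a, h1, h2⟩ | ⟨a, h1, h2⟩⟩
    · exact ⟨a, h1, Or.inl h2⟩
    · exact ⟨a, h1, Or.inr h2⟩
  · rintro ⟨a, h1, h2⟩
    exact ⟨Arc.Joins.ne h2, h2.elim (fun h => Or.inl ⟨a, h1, h⟩) fun h => Or.inr ⟨a, h1, h⟩⟩

/-- A connected graph has an arc between any proper nonempty set of letters and its complement. -/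
theorem OGraph.exists_boundary {G : OGraph X} (hG : G.toSimpleGraph.Connected) {Y : Finset X}
    {y z : X} (hy : y ∈ Y) (hz : z ∉ Y) : ∃ a ∈ G, ∃ w x, w ∈ Y ∧ x ∉ Y ∧ a.Joins w x := by
  obtain ⟨p⟩ := hG.preconnected y z
  obtain ⟨d, -, h1, h2⟩ := p.exists_boundary_dart (↑Y) (by simpa using hy) (by simpa using hz)
  obtain ⟨a, ha, hj⟩ := OGraph.adj_iff.mp d.adj
  exact ⟨a, ha, _, _, by simpa using h1, by simpa using h2, hj⟩

theorem OGraph.exists_spanningTree [Fintype X] {G : OGraph X}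
    (hG : G.toSimpleGraph.Connected) :
    ∃ T H, G = T + H ∧ TreeOn Finset.univ T := by
  obtain ⟨x₀⟩ := hG.nonempty
  have key : ∀ k : ℕ, ∃ (Y : Finset X) (T H : OGraph X), G = T + H ∧ TreeOn Y T ∧
      (Y = Finset.univ ∨ k < Y.card) := by
    intro k
    induction k with
    | zero => exact ⟨{x₀}, 0, G, by simp, .point x₀, by simp⟩
    | succ k ih =>
      obtain ⟨Y, T, H, hTH, hT, hY⟩ := ih
      by_cases hu : Y = Finset.univ
      · exact ⟨Y, T, H, hTH, hT, Or.inl hu⟩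
      obtain ⟨z, hz⟩ : ∃ z, z ∉ Y := by
        by_contra h; push Not at h; exact hu (by ext; simp [h])
      obtain ⟨y, hy⟩ := hT.nonempty
      obtain ⟨a, ha, w, x, hw, hx, hj⟩ := OGraph.exists_boundary hG hy hz
      have haH : a ∈ H := by
        rw [hTH, Multiset.mem_add] at ha
        refine ha.resolve_left fun haT => hx ?_
        rcases hj with ⟨-, rfl⟩ | ⟨rfl, -⟩
        · exact (hT.mem a haT).2
        · exact (hT.mem a haT).1
      obtain ⟨H', rfl⟩ := Multiset.exists_cons_of_mem haH
      refine ⟨_, _, H', ?_, hT.leaf hw hx a hj, Or.inr ?_⟩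
      · rw [hTH, ← Multiset.singleton_add]; abel
      · rw [Finset.card_insert_of_notMem hx]
        have := hY.resolve_left hu
        omega
  obtain ⟨Y, T, H, h1, h2, h3⟩ := key (Fintype.card X)
  have : Y = Finset.univ := h3.resolve_right (not_lt.mpr (Finset.card_le_univ Y))
  exact ⟨T, H, h1, this ▸ h2⟩

/-- The colour of an arc is consistent with exactly one of its directions, so an arc that is not
consistent becomes so by reversal, without recolouring. -/
theorem Arc.eq_outArc_or (a : Arc X) :
    {a} = outArc a.src a.tgt ∨ {a} = carc (colorOf a.tgt a.src) a.src a.tgt := by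
  rcases a with ⟨s, t, h, c⟩
  rw [outArc, carc_of_ne h, carc_of_ne h]
  rcases h.lt_or_gt with h' | h' <;> cases c <;> simp [colorOf, h', h'.not_gt]

theorem mem_of_joins {S : Submodule R (Gam R X)} (hS : localRelations R X ≤ S) {a : Arc X}
    {u v : X} (ha : a.Joins u v) {H : OGraph X} (h1 : single R (outArc u v + H) ∈ S)
    (h2 : single R (outArc v u + H) ∈ S) : single R ({a} + H) ∈ S := by
  rcases ha with ⟨rfl, rfl⟩ | ⟨rfl, rfl⟩ <;> rcases a.eq_outArc_or with h | h <;> rw [h]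
  · exact h1
  · exact (mem_carc_comm hS).mp h2
  · exact h2
  · exact (mem_carc_comm hS).mp h1

theorem TreeOn.mem_of_dtree {S : Submodule R (Gam R X)} (hS : localRelations R X ≤ S)
    {Y : Finset X} {G : OGraph X} (hG : TreeOn Y G) :
    ∀ {H : OGraph X}, (∀ T, DTree Y T → single R (T + H) ∈ S) → single R (G + H) ∈ S := by
  induction hG with
  | point r => intro H h; exact h 0 (.point r)
  | leaf _ hw hx a ha ih =>
    intro H h
    rw [add_assoc, add_left_comm]
    refine ih fun T hT => ?_
    rw [add_left_comm]
    refine mem_of_joins hS ha ?_ ?_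
    · exact mem_congr (h _ (hT.out hw hx)) (by abel)
    · exact mem_congr (h _ (hT.inn hw hx)) (by abel)

/-- Outside a spanning tree there is either no arc, and the graph is a tree, or an arc that closes a
cycle with the tree path between its ends. -/
theorem single_mem_relations_sup [Fintype X] (G : OGraph X) :
    single R G ∈ relations R X ⊔
      Submodule.span R {x | ∃ r G, RootedTree Finset.univ r G ∧ x = single R G} := by
  by_cases hG : G.toSimpleGraph.Connected
  swap
  · exact Submodule.mem_sup_left (Submodule.subset_span (Or.inr ⟨G, hG, rfl⟩))
  have hS : rootedSpan R (Finset.univ : Finset X) ≤ relations R X ⊔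
      Submodule.span R {x | ∃ r G, RootedTree Finset.univ r G ∧ x = single R G} :=
    sup_le_sup_right localRelations_le _
  refine hS ?_
  obtain ⟨T, H, rfl, hT⟩ := OGraph.exists_spanningTree hG
  rcases Multiset.empty_or_exists_mem H with rfl | ⟨a, ha⟩
  · refine hT.mem_of_dtree (localRelations_le_rootedSpan _) fun T hT => ?_
    rw [add_zero]; exact hT.mem_rootedSpan
  · obtain ⟨H, rfl⟩ := Multiset.exists_cons_of_mem ha
    obtain ⟨m, P, Q, hP, rfl⟩ := hT.exists_walk (Finset.mem_univ a.src) (Finset.mem_univ a.tgt)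
    have h : single R ({a} + (P + (Q + H))) ∈ rootedSpan R (Finset.univ : Finset X) := by
      rw [mem_joins (localRelations_le_rootedSpan _) (u := a.tgt) (v := a.src) (Or.inr ⟨rfl, rfl⟩),
        ← add_assoc]
      exact mem_of_cycle (localRelations_le_rootedSpan _) m hP a.ne _ _
    refine mem_congr h ?_
    rw [← Multiset.singleton_add]; abel

end EilTwo

/-! ### Independence of the rooted trees -/

namespace EilTwo

variable {R : Type*} [CommRing R] {X : Type*} [LinearOrder X]

/-! ### Functionals given by bicoloured binary trees -/

instance : DecidableEq EdgeColor
  | .red, .red => isTrue rfl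
  | .blue, .blue => isTrue rfl
  | .red, .blue => isFalse nofun
  | .blue, .red => isFalse nofun

/-- The arcs of `G` with both ends in `A`. -/
def restrict (A : Finset X) (G : OGraph X) : OGraph X :=
  G.filter fun a => a.src ∈ A ∧ a.tgt ∈ A

/-- The arcs of `G` that neither have both ends in `A` nor both ends in `B`. -/
def cross (A B : Finset X) (G : OGraph X) : OGraph X :=
  G.filter fun a => ¬ (a.src ∈ A ∧ a.tgt ∈ A) ∧ ¬ (a.src ∈ B ∧ a.tgt ∈ B)

/-- The sign of an arc between `A` and `B`, with respect to the colour `c`. -/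
def arcSign (c : EdgeColor) (A : Finset X) (a : Arc X) : ℤ :=
  if a.color = c then if a.src ∈ A then 1 else -1 else 0

/-- The sign of the only arc of a graph, and `0` if there is not exactly one arc. -/
def crossSign (c : EdgeColor) (A : Finset X) (M : OGraph X) : ℤ :=
  if M.card = 1 then (M.map (arcSign c A)).sum else 0

theorem crossSign_cons (c : EdgeColor) (A : Finset X) (a : Arc X) (M : OGraph X) :
    crossSign c A (a ::ₘ M) = if M.card = 0 then arcSign c A a else 0 := by
  by_cases h : M.card = 0
  · rw [Multiset.card_eq_zero] at h; subst h; simp [crossSign]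
  · simp [crossSign, Multiset.card_eq_zero.not.mp h]

theorem restrict_cons_pos {A : Finset X} {a : Arc X} {G : OGraph X} (h1 : a.src ∈ A)
    (h2 : a.tgt ∈ A) : restrict A (a ::ₘ G) = a ::ₘ restrict A G := by
  simp [restrict, h1, h2]

theorem restrict_cons_neg {A : Finset X} {a : Arc X} {G : OGraph X}
    (h : a.src ∉ A ∨ a.tgt ∉ A) : restrict A (a ::ₘ G) = restrict A G := by
  rw [restrict, Multiset.filter_cons_of_neg _ (by tauto)]; rfl

theorem cross_cons_left {A B : Finset X} {a : Arc X} {G : OGraph X} (h1 : a.src ∈ A)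
    (h2 : a.tgt ∈ A) : cross A B (a ::ₘ G) = cross A B G := by
  simp [cross, h1, h2]

theorem cross_cons_right {A B : Finset X} {a : Arc X} {G : OGraph X} (h1 : a.src ∈ B)
    (h2 : a.tgt ∈ B) : cross A B (a ::ₘ G) = cross A B G := by
  simp [cross, h1, h2]

theorem cross_cons_pos {A B : Finset X} {a : Arc X} {G : OGraph X} (h1 : a.src ∉ A ∨ a.tgt ∉ A)
    (h2 : a.src ∉ B ∨ a.tgt ∉ B) : cross A B (a ::ₘ G) = a ::ₘ cross A B G := by
  rw [cross, Multiset.filter_cons_of_pos _ (by tauto)]; rfl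

theorem exists_cross_eq_singleton {c : EdgeColor} {A B : Finset X} {G : OGraph X}
    (h : crossSign c A (cross A B G) ≠ 0) : ∃ a, cross A B G = {a} := by
  rw [← Multiset.card_eq_one]
  by_contra hc
  exact h (by simp [crossSign, hc])

/-- Binary trees with leaves labelled by letters and coloured internal vertices. -/
inductive BinTree (X : Type*)
  | leaf (x : X)
  | node (c : EdgeColor) (l r : BinTree X)

namespace BinTree

/-- The labels of the leaves. -/
def leaves : BinTree X → Finset X
  | leaf x => {x}
  | node _ l r => l.leaves ∪ r.leaves

/-- The leaves have distinct labels. -/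
def Valid : BinTree X → Prop
  | leaf _ => True
  | node _ l r => l.Valid ∧ r.Valid ∧ Disjoint l.leaves r.leaves

/-- The pairing of a bicoloured binary tree with an oriented two-coloured graph. -/
def pairing : BinTree X → OGraph X → ℤ
  | leaf _, G => if G.card = 0 then 1 else 0
  | node c l r, G => crossSign c l.leaves (cross l.leaves r.leaves G) *
      (l.pairing (restrict l.leaves G) * r.pairing (restrict r.leaves G))

section Node

variable {c : EdgeColor} {l r : BinTree X} (hd : Disjoint l.leaves r.leaves) {a b : Arc X}
  {G : OGraph X}

include hd

theorem pairing_node_left (h1 : a.src ∈ l.leaves) (h2 : a.tgt ∈ l.leaves) :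
    (node c l r).pairing (a ::ₘ G) = crossSign c l.leaves (cross l.leaves r.leaves G) *
      (l.pairing (a ::ₘ restrict l.leaves G) * r.pairing (restrict r.leaves G)) := by
  rw [pairing, cross_cons_left h1 h2, restrict_cons_pos h1 h2,
    restrict_cons_neg (Or.inl (Finset.disjoint_left.mp hd h1))]

theorem pairing_node_right (h1 : a.src ∈ r.leaves) (h2 : a.tgt ∈ r.leaves) :
    (node c l r).pairing (a ::ₘ G) = crossSign c l.leaves (cross l.leaves r.leaves G) *
      (l.pairing (restrict l.leaves G) * r.pairing (a ::ₘ restrict r.leaves G)) := by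
  rw [pairing, cross_cons_right h1 h2, restrict_cons_pos h1 h2,
    restrict_cons_neg (Or.inl (Finset.disjoint_right.mp hd h1))]

theorem pairing_node_cross
    (h : a.src ∈ l.leaves ∧ a.tgt ∈ r.leaves ∨ a.src ∈ r.leaves ∧ a.tgt ∈ l.leaves) :
    (node c l r).pairing (a ::ₘ G) =
      (if (cross l.leaves r.leaves G).card = 0 then arcSign c l.leaves a else 0) *
      (l.pairing (restrict l.leaves G) * r.pairing (restrict r.leaves G)) := by
  have h1 : a.src ∉ l.leaves ∨ a.tgt ∉ l.leaves := h.elim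
    (fun h => Or.inr (Finset.disjoint_right.mp hd h.2))
    (fun h => Or.inl (Finset.disjoint_right.mp hd h.1))
  have h2 : a.src ∉ r.leaves ∨ a.tgt ∉ r.leaves := h.elim
    (fun h => Or.inl (Finset.disjoint_left.mp hd h.1))
    (fun h => Or.inr (Finset.disjoint_left.mp hd h.2))
  rw [pairing, cross_cons_pos h1 h2, restrict_cons_neg h1, restrict_cons_neg h2, crossSign_cons]

theorem pairing_node_cross_cross
    (ha : a.src ∈ l.leaves ∧ a.tgt ∈ r.leaves ∨ a.src ∈ r.leaves ∧ a.tgt ∈ l.leaves)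
    (hb : b.src ∈ l.leaves ∧ b.tgt ∈ r.leaves ∨ b.src ∈ r.leaves ∧ b.tgt ∈ l.leaves) :
    (node c l r).pairing (a ::ₘ b ::ₘ G) = 0 := by
  have h1 : b.src ∉ l.leaves ∨ b.tgt ∉ l.leaves := hb.elim
    (fun h => Or.inr (Finset.disjoint_right.mp hd h.2))
    (fun h => Or.inl (Finset.disjoint_right.mp hd h.1))
  have h2 : b.src ∉ r.leaves ∨ b.tgt ∉ r.leaves := hb.elim
    (fun h => Or.inl (Finset.disjoint_left.mp hd h.1))
    (fun h => Or.inr (Finset.disjoint_left.mp hd h.2))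
  rw [pairing_node_cross hd ha, cross_cons_pos h1 h2]
  simp

theorem pairing_node_left_cross (h1 : a.src ∈ l.leaves) (h2 : a.tgt ∈ l.leaves)
    (h : b.src ∈ l.leaves ∧ b.tgt ∈ r.leaves ∨ b.src ∈ r.leaves ∧ b.tgt ∈ l.leaves) :
    (node c l r).pairing (a ::ₘ b ::ₘ G) =
      (if (cross l.leaves r.leaves G).card = 0 then arcSign c l.leaves b else 0) *
      (l.pairing (a ::ₘ restrict l.leaves G) * r.pairing (restrict r.leaves G)) := by
  rw [Multiset.cons_swap, pairing_node_cross hd h, cross_cons_left h1 h2, restrict_cons_pos h1 h2,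
    restrict_cons_neg (Or.inl (Finset.disjoint_left.mp hd h1))]

theorem pairing_node_right_cross (h1 : a.src ∈ r.leaves) (h2 : a.tgt ∈ r.leaves)
    (h : b.src ∈ l.leaves ∧ b.tgt ∈ r.leaves ∨ b.src ∈ r.leaves ∧ b.tgt ∈ l.leaves) :
    (node c l r).pairing (a ::ₘ b ::ₘ G) =
      (if (cross l.leaves r.leaves G).card = 0 then arcSign c l.leaves b else 0) *
      (l.pairing (restrict l.leaves G) * r.pairing (a ::ₘ restrict r.leaves G)) := by
  rw [Multiset.cons_swap, pairing_node_cross hd h, cross_cons_right h1 h2, restrict_cons_pos h1 h2,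
    restrict_cons_neg (Or.inl (Finset.disjoint_right.mp hd h1))]

theorem pairing_node_left_left (h1 : a.src ∈ l.leaves) (h2 : a.tgt ∈ l.leaves)
    (h3 : b.src ∈ l.leaves) (h4 : b.tgt ∈ l.leaves) :
    (node c l r).pairing (a ::ₘ b ::ₘ G) = crossSign c l.leaves (cross l.leaves r.leaves G) *
      (l.pairing (a ::ₘ b ::ₘ restrict l.leaves G) * r.pairing (restrict r.leaves G)) := by
  rw [pairing_node_left hd h1 h2, cross_cons_left h3 h4, restrict_cons_pos h3 h4,
    restrict_cons_neg (Or.inl (Finset.disjoint_left.mp hd h3))]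

theorem pairing_node_right_right (h1 : a.src ∈ r.leaves) (h2 : a.tgt ∈ r.leaves)
    (h3 : b.src ∈ r.leaves) (h4 : b.tgt ∈ r.leaves) :
    (node c l r).pairing (a ::ₘ b ::ₘ G) = crossSign c l.leaves (cross l.leaves r.leaves G) *
      (l.pairing (restrict l.leaves G) * r.pairing (a ::ₘ b ::ₘ restrict r.leaves G)) := by
  rw [pairing_node_right hd h1 h2, cross_cons_right h3 h4, restrict_cons_pos h3 h4,
    restrict_cons_neg (Or.inl (Finset.disjoint_right.mp hd h3))]

end Node

/-- Only the internal vertex that separates the two ends of the arc sees its direction, and there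
the sign changes. -/
theorem pairing_reverse {T : BinTree X} (hT : T.Valid) :
    ∀ {a : Arc X} {G : OGraph X}, a.src ∈ T.leaves → a.tgt ∈ T.leaves →
      T.pairing (a ::ₘ G) + T.pairing (a.reverse ::ₘ G) = 0 := by
  induction T with
  | leaf x => intro a G _ _; simp [pairing]
  | node c l r ihl ihr =>
    obtain ⟨hl, hr, hd⟩ := hT
    intro a G h1 h2
    simp only [leaves, Finset.mem_union] at h1 h2
    have hd' : ∀ x ∈ r.leaves, x ∉ l.leaves := fun x hx => Finset.disjoint_right.mp hd hx
    rcases h1 with h1 | h1 <;> rcases h2 with h2 | h2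
    · rw [pairing_node_left hd h1 h2, pairing_node_left hd (a := a.reverse) h2 h1]
      linear_combination crossSign c l.leaves (cross l.leaves r.leaves G) *
        r.pairing (restrict r.leaves G) * ihl hl h1 h2 (G := restrict l.leaves G)
    · rw [pairing_node_cross hd (Or.inl ⟨h1, h2⟩),
        pairing_node_cross hd (a := a.reverse) (Or.inr ⟨h2, h1⟩)]
      simp only [arcSign, Arc.reverse, h1, hd' _ h2, if_true, if_false]
      split_ifs <;> ring
    · rw [pairing_node_cross hd (Or.inr ⟨h1, h2⟩),
        pairing_node_cross hd (a := a.reverse) (Or.inl ⟨h2, h1⟩)]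
      simp only [arcSign, Arc.reverse, h2, hd' _ h1, if_true, if_false]
      split_ifs <;> ring
    · rw [pairing_node_right hd h1 h2, pairing_node_right hd (a := a.reverse) h2 h1]
      linear_combination crossSign c l.leaves (cross l.leaves r.leaves G) *
        l.pairing (restrict l.leaves G) * ihr hr h1 h2 (G := restrict r.leaves G)

/-- Parallel arcs are separated at the same internal vertex, where two crossing arcs give zero. -/
theorem pairing_parallel {T : BinTree X} (hT : T.Valid) :
    ∀ {a b : Arc X} {G : OGraph X}, a.Parallel b → a.src ∈ T.leaves → a.tgt ∈ T.leaves →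
      T.pairing (a ::ₘ b ::ₘ G) = 0 := by
  induction T with
  | leaf x => intro a b G _ _ _; simp [pairing]
  | node c l r ihl ihr =>
    obtain ⟨hl, hr, hd⟩ := hT
    intro a b G hab h1 h2
    simp only [leaves, Finset.mem_union] at h1 h2
    have hb : ∀ {A : Finset X}, a.src ∈ A → a.tgt ∈ A → b.src ∈ A ∧ b.tgt ∈ A := by
      rintro A h1 h2
      rcases hab with ⟨e1, e2⟩ | ⟨e1, e2⟩
      · rw [← e1, ← e2]; exact ⟨h1, h2⟩
      · rw [← e1, ← e2]; exact ⟨h2, h1⟩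
    rcases h1 with h1 | h1 <;> rcases h2 with h2 | h2
    · rw [pairing_node_left_left hd h1 h2 (hb h1 h2).1 (hb h1 h2).2, ihl hl hab h1 h2]
      simp
    · refine pairing_node_cross_cross hd (Or.inl ⟨h1, h2⟩) ?_
      rcases hab with ⟨e1, e2⟩ | ⟨e1, e2⟩
      · exact Or.inl ⟨e1 ▸ h1, e2 ▸ h2⟩
      · exact Or.inr ⟨e2 ▸ h2, e1 ▸ h1⟩
    · refine pairing_node_cross_cross hd (Or.inr ⟨h1, h2⟩) ?_
      rcases hab with ⟨e1, e2⟩ | ⟨e1, e2⟩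
      · exact Or.inr ⟨e1 ▸ h1, e2 ▸ h2⟩
      · exact Or.inl ⟨e2 ▸ h2, e1 ▸ h1⟩
    · rw [pairing_node_right_right hd h1 h2 (hb h1 h2).1 (hb h1 h2).2, ihr hr hab h1 h2]
      simp

/-- The pairing with a sum of six graphs which is a Jacobi combination if the two colours are equal,
twice over. -/
theorem pairing_jacobi {T : BinTree X} (hT : T.Valid) (d e : EdgeColor) :
    ∀ {i j k : X} (hij : i ≠ j) (hjk : j ≠ k) (hki : k ≠ i) {G : OGraph X},
      i ∈ T.leaves → j ∈ T.leaves → k ∈ T.leaves →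
      (T.pairing (⟨i, j, hij, d⟩ ::ₘ ⟨j, k, hjk, e⟩ ::ₘ G)
        + T.pairing (⟨j, k, hjk, d⟩ ::ₘ ⟨k, i, hki, e⟩ ::ₘ G)
        + T.pairing (⟨k, i, hki, d⟩ ::ₘ ⟨i, j, hij, e⟩ ::ₘ G))
      + (T.pairing (⟨i, j, hij, e⟩ ::ₘ ⟨j, k, hjk, d⟩ ::ₘ G)
        + T.pairing (⟨j, k, hjk, e⟩ ::ₘ ⟨k, i, hki, d⟩ ::ₘ G)
        + T.pairing (⟨k, i, hki, e⟩ ::ₘ ⟨i, j, hij, d⟩ ::ₘ G)) = 0 := by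
  induction T with
  | leaf x => intros; simp [pairing]
  | node c l r ihl ihr =>
    obtain ⟨hl, hr, hd⟩ := hT
    intro i j k hij hjk hki G h1 h2 h3
    simp only [leaves, Finset.mem_union] at h1 h2 h3
    have hd' : ∀ x ∈ r.leaves, x ∉ l.leaves := fun x hx => Finset.disjoint_right.mp hd hx
    have swap : ∀ a b : Arc X, (node c l r).pairing (a ::ₘ b ::ₘ G) =
        (node c l r).pairing (b ::ₘ a ::ₘ G) := fun a b => by rw [Multiset.cons_swap]
    -- If one letter is separated from the other two, the graphs with two crossing arcs vanish. The
    -- four others share the inner edge and cancel in pairs of equal colouring, as their crossing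
    -- arcs have opposite signs. `swap` puts the inner arc first.
    rcases h1 with h1 | h1 <;> rcases h2 with h2 | h2 <;> rcases h3 with h3 | h3
    · simp only [pairing_node_left_left hd, h1, h2, h3]
      linear_combination crossSign c l.leaves (cross l.leaves r.leaves G) *
        r.pairing (restrict r.leaves G) * ihl hl hij hjk hki h1 h2 h3 (G := restrict l.leaves G)
    · rw [swap ⟨k, i, hki, d⟩, swap ⟨k, i, hki, e⟩]
      simp only [pairing_node_left_cross hd, pairing_node_cross_cross hd, h1, h2, h3,
        and_self, true_or, or_true, arcSign, hd' _ h3, if_true, if_false]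
      split_ifs <;> ring
    · rw [swap ⟨j, k, hjk, d⟩, swap ⟨j, k, hjk, e⟩]
      simp only [pairing_node_left_cross hd, pairing_node_cross_cross hd, h1, h2, h3,
        and_self, true_or, or_true, arcSign, hd' _ h2, if_true, if_false]
      split_ifs <;> ring
    · rw [swap ⟨i, j, hij, d⟩, swap ⟨i, j, hij, e⟩]
      simp only [pairing_node_right_cross hd, pairing_node_cross_cross hd, h1, h2, h3,
        and_self, true_or, or_true, arcSign, hd' _ h2, hd' _ h3, if_true, if_false]
      split_ifs <;> ring
    · rw [swap ⟨i, j, hij, d⟩, swap ⟨i, j, hij, e⟩]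
      simp only [pairing_node_left_cross hd, pairing_node_cross_cross hd, h1, h2, h3,
        and_self, true_or, or_true, arcSign, hd' _ h1, if_true, if_false]
      split_ifs <;> ring
    · rw [swap ⟨j, k, hjk, d⟩, swap ⟨j, k, hjk, e⟩]
      simp only [pairing_node_right_cross hd, pairing_node_cross_cross hd, h1, h2, h3,
        and_self, true_or, or_true, arcSign, hd' _ h1, hd' _ h3, if_true, if_false]
      split_ifs <;> ring
    · rw [swap ⟨k, i, hki, d⟩, swap ⟨k, i, hki, e⟩]
      simp only [pairing_node_right_cross hd, pairing_node_cross_cross hd, h1, h2, h3,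
        and_self, true_or, or_true, arcSign, hd' _ h1, hd' _ h2, if_true, if_false]
      split_ifs <;> ring
    · simp only [pairing_node_right_right hd, h1, h2, h3]
      linear_combination crossSign c l.leaves (cross l.leaves r.leaves G) *
        l.pairing (restrict l.leaves G) * ihr hr hij hjk hki h1 h2 h3 (G := restrict r.leaves G)

theorem leaves_nonempty (T : BinTree X) : T.leaves.Nonempty := by
  induction T with
  | leaf x => simp [leaves]
  | node c l r ihl _ => exact ihl.mono Finset.subset_union_left

/-- A graph whose pairing with a tree is nonzero connects the leaves of the tree. -/
theorem reachable_of_pairing_ne_zero {T : BinTree X} :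
    ∀ {G H : OGraph X}, H ≤ G → (∀ a ∈ H, a.src ∈ T.leaves ∧ a.tgt ∈ T.leaves) →
      T.pairing H ≠ 0 → ∀ x ∈ T.leaves, ∀ y ∈ T.leaves, G.toSimpleGraph.Reachable x y := by
  induction T with
  | leaf x =>
    intro G H _ _ _ y hy z hz
    rw [Finset.mem_singleton.mp hy, Finset.mem_singleton.mp hz]
  | node c l r ihl ihr =>
    intro G H hGH hH h
    rw [pairing, mul_ne_zero_iff, mul_ne_zero_iff] at h
    obtain ⟨h0, h1, h2⟩ := h
    have hl := ihl (G := G) ((Multiset.filter_le _ _).trans hGH)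
      (fun a ha => (Multiset.mem_filter.mp ha).2) h1
    have hr := ihr (G := G) ((Multiset.filter_le _ _).trans hGH)
      (fun a ha => (Multiset.mem_filter.mp ha).2) h2
    obtain ⟨a, ha⟩ := exists_cross_eq_singleton h0
    have ham : a ∈ cross l.leaves r.leaves H := by simp [ha]
    obtain ⟨haH, ha1, ha2⟩ := Multiset.mem_filter.mp ham
    have hadj : G.toSimpleGraph.Adj a.src a.tgt :=
      OGraph.adj_iff.mpr ⟨a, Multiset.mem_of_le hGH haH, Or.inl ⟨rfl, rfl⟩⟩
    obtain ⟨hs, ht⟩ := hH a haH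
    simp only [leaves, Finset.mem_union] at hs ht
    obtain ⟨p, hp, q, hq, hpq⟩ : ∃ p ∈ l.leaves, ∃ q ∈ r.leaves, G.toSimpleGraph.Adj p q := by
      rcases hs with hs | hs <;> rcases ht with ht | ht
      · exact absurd ⟨hs, ht⟩ ha1
      · exact ⟨_, hs, _, ht, hadj⟩
      · exact ⟨_, ht, _, hs, hadj.symm⟩
      · exact absurd ⟨hs, ht⟩ ha2
    have hlr : ∀ x ∈ l.leaves, ∀ y ∈ r.leaves, G.toSimpleGraph.Reachable x y :=
      fun x hx y hy => ((hl x hx p hp).trans hpq.reachable).trans (hr q hq y hy)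
    intro x hx y hy
    simp only [leaves, Finset.mem_union] at hx hy
    rcases hx with hx | hx <;> rcases hy with hy | hy
    · exact hl x hx y hy
    · exact hlr x hx y hy
    · exact (hlr y hy x hx).symm
    · exact hr x hx y hy

variable (R) in
/-- The linear functional given by the pairing with a tree. -/
noncomputable def functional (T : BinTree X) : Gam R X →ₗ[R] R :=
  Finsupp.linearCombination R fun G => (T.pairing G : R)

theorem functional_single (T : BinTree X) (G : OGraph X) :
    T.functional R (single R G) = (T.pairing G : R) := by
  simp [functional, single]

theorem functional_apply (T : BinTree X) (x : Gam R X) :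
    T.functional R x = x.sum fun G a => a * (T.pairing G : R) := by
  simp [functional, Finsupp.linearCombination_apply]

/-- All letters must be leaves: then every arc of a graph is seen by the pairing, and a nonzero
pairing forces the graph to be connected. -/
theorem functional_relations [Fintype X] {T : BinTree X} (hT : T.Valid)
    (hl : T.leaves = Finset.univ) {x : Gam R X} (hx : x ∈ relations R X) :
    T.functional R x = 0 := by
  suffices h : relations R X ≤ LinearMap.ker (T.functional R) from h hx
  have hm : ∀ x, x ∈ T.leaves := by simp [hl]
  refine Submodule.span_le.mpr ?_
  rintro x ((((⟨H, a, rfl⟩ | ⟨H, i, j, k, hij, hjk, hki, c, rfl⟩) |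
    ⟨H, i, j, k, hij, hjk, hki, rfl⟩) | ⟨H, a, b, hab, rfl⟩) | ⟨G, hG, rfl⟩)
  all_goals
    simp only [SetLike.mem_coe, LinearMap.mem_ker, map_add, functional_single]
  · exact_mod_cast congrArg (Int.cast : ℤ → R)
      (pairing_reverse hT (a := a) (G := H) (hm _) (hm _))
  · have h := pairing_jacobi hT c c hij hjk hki (G := H) (hm _) (hm _) (hm _)
    -- For equal colours the six terms are the Jacobi combination taken twice. The factor two is
    -- cancelled in `ℤ`, before the cast to `R`, where it might be a zero divisor.
    have h' : T.pairing (⟨i, j, hij, c⟩ ::ₘ ⟨j, k, hjk, c⟩ ::ₘ H)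
        + T.pairing (⟨j, k, hjk, c⟩ ::ₘ ⟨k, i, hki, c⟩ ::ₘ H)
        + T.pairing (⟨k, i, hki, c⟩ ::ₘ ⟨i, j, hij, c⟩ ::ₘ H) = 0 := by omega
    exact_mod_cast congrArg (Int.cast : ℤ → R) h'
  · exact_mod_cast congrArg (Int.cast : ℤ → R)
      (pairing_jacobi hT .blue .red hij hjk hki (G := H) (hm _) (hm _) (hm _))
  · rw [pairing_parallel hT hab (hm _) (hm _), Int.cast_zero]
  · by_contra h
    have h' : T.pairing G ≠ 0 := fun h0 => h (by simp [h0])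
    obtain ⟨x, -⟩ := T.leaves_nonempty
    exact hG { preconnected := fun x y => reachable_of_pairing_ne_zero le_rfl
                (fun a _ => ⟨hm _, hm _⟩) h' x (hm x) y (hm y)
               nonempty := ⟨x⟩ }

end BinTree
end EilTwo

namespace EilTwo

variable {R : Type*} [CommRing R] {X : Type*} [LinearOrder X]

/-! ### Cutting rooted trees -/

theorem outArc_of_ne {u v : X} (h : u ≠ v) : outArc u v = {⟨u, v, h, colorOf u v⟩} :=
  carc_of_ne h

namespace RootedTree

theorem mem {Y : Finset X} {r : X} {G : OGraph X} (h : RootedTree Y r G) :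
    ∀ a ∈ G, a.src ∈ Y ∧ a.tgt ∈ Y ∧ a.tgt ≠ r ∧ a.color = colorOf a.src a.tgt := by
  induction h with
  | point r => simp
  | graft h hw hx ih =>
    intro a ha
    rw [Multiset.mem_add, mem_outArc] at ha
    rcases ha with ⟨rfl, rfl, hc⟩ | ha
    · exact ⟨by simp [hw], by simp, fun e => hx (e ▸ h.root_mem), hc⟩
    · obtain ⟨h1, h2, h3⟩ := ih a ha
      exact ⟨by simp [h1], by simp [h2], h3⟩

theorem exists_tgt {Y : Finset X} {r : X} {G : OGraph X} (h : RootedTree Y r G) :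
    ∀ v ∈ Y, v ≠ r → ∃ a ∈ G, a.tgt = v := by
  induction h with
  | point r => intro v hv hr; exact absurd (Finset.mem_singleton.mp hv) hr
  | @graft Y r G w x h hw hx ih =>
    intro v hv hr
    by_cases hvx : v = x
    · subst hvx
      have hwv : w ≠ v := fun e => hx (e ▸ hw)
      exact ⟨⟨w, v, hwv, colorOf w v⟩, by simp [outArc_of_ne hwv], rfl⟩
    · obtain ⟨a, ha, h'⟩ := ih v (by simpa [hvx] using hv) hr
      exact ⟨a, by simp [ha], h'⟩

theorem eq_of_tgt {Y : Finset X} {r : X} {G : OGraph X} (h : RootedTree Y r G) :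
    ∀ a ∈ G, ∀ b ∈ G, a.tgt = b.tgt → a = b := by
  induction h with
  | point r => simp
  | @graft Y r G w x h hw hx ih =>
    have hwx : w ≠ x := fun e => hx (e ▸ hw)
    intro a ha b hb hab
    rw [outArc_of_ne hwx, Multiset.mem_add, Multiset.mem_singleton] at ha hb
    rcases ha with rfl | ha <;> rcases hb with rfl | hb
    · rfl
    · exact absurd (h.mem b hb).2.1 (by rw [← hab]; exact hx)
    · exact absurd (h.mem a ha).2.1 (by rw [hab]; exact hx)
    · exact ih a ha b hb hab

theorem exists_boundary {Y : Finset X} {r : X} {G : OGraph X} (h : RootedTree Y r G) :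
    ∀ {A : Finset X}, (∃ y ∈ Y, y ∈ A) → (∃ z ∈ Y, z ∉ A) →
      ∃ a ∈ G, ¬ (a.src ∈ A ↔ a.tgt ∈ A) := by
  induction h with
  | point r =>
    rintro A ⟨y, hy, hyA⟩ ⟨z, hz, hzA⟩
    rw [Finset.mem_singleton.mp hy] at hyA
    rw [Finset.mem_singleton.mp hz] at hzA
    exact absurd hyA hzA
  | @graft Y r G w x h hw hx ih =>
    have hwx : w ≠ x := fun e => hx (e ▸ hw)
    rintro A ⟨y, hy, hyA⟩ ⟨z, hz, hzA⟩
    by_cases hwA : w ∈ A ↔ x ∈ A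
    · have hY : ∀ (p : X → Prop), (p w ↔ p x) → (∃ y ∈ insert x Y, p y) → ∃ y ∈ Y, p y := by
        rintro p hp ⟨y, hy, hpy⟩
        rcases Finset.mem_insert.mp hy with rfl | hy
        · exact ⟨w, hw, hp.mpr hpy⟩
        · exact ⟨y, hy, hpy⟩
      obtain ⟨a, ha, h'⟩ := ih (A := A) (hY (· ∈ A) hwA ⟨y, hy, hyA⟩)
        (hY (· ∉ A) (not_congr hwA) ⟨z, hz, hzA⟩)
      exact ⟨a, by simp [ha], h'⟩
    · exact ⟨⟨w, x, hwx, colorOf w x⟩, by rw [outArc_of_ne hwx]; simp, hwA⟩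

end RootedTree

theorem cross_comm (A B : Finset X) (G : OGraph X) : cross A B G = cross B A G :=
  Multiset.filter_congr fun _ _ => and_comm

/-- A graph with all arcs in `A ∪ B` splits into its restrictions and the arcs in between. -/
theorem restrict_add_restrict_add_cross {A B : Finset X} (hd : Disjoint A B) (G : OGraph X) :
    restrict A G + restrict B G + cross A B G = G := by
  induction G using Multiset.induction_on with
  | empty => simp [restrict, cross]
  | cons a G ih =>
    by_cases hA : a.src ∈ A ∧ a.tgt ∈ A
    · rw [restrict_cons_pos hA.1 hA.2, cross_cons_left hA.1 hA.2,
        restrict_cons_neg (Or.inl (Finset.disjoint_left.mp hd hA.1)),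
        Multiset.cons_add, Multiset.cons_add, ih]
    by_cases hB : a.src ∈ B ∧ a.tgt ∈ B
    · rw [restrict_cons_pos hB.1 hB.2, cross_cons_right hB.1 hB.2,
        restrict_cons_neg (Or.inl (Finset.disjoint_right.mp hd hB.1)),
        Multiset.add_cons, Multiset.cons_add, ih]
    · have hA' := not_and_or.mp hA
      have hB' := not_and_or.mp hB
      rw [restrict_cons_neg hA', restrict_cons_neg hB',
        cross_cons_pos hA' hB', Multiset.add_cons, ih]

/-- Cutting a rooted tree along an arc. -/
theorem RootedTree.cut {Y : Finset X} {r : X} {G : OGraph X} (h : RootedTree Y r G) :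
    ∀ {A B : Finset X} {a : Arc X}, A ∪ B = Y → Disjoint A B → cross A B G = {a} →
      (a.src ∈ A ∧ a.tgt ∈ B ∧ RootedTree A r (restrict A G) ∧
        RootedTree B a.tgt (restrict B G)) ∨
      (a.src ∈ B ∧ a.tgt ∈ A ∧ RootedTree B r (restrict B G) ∧
        RootedTree A a.tgt (restrict A G)) := by
  induction h with
  | point r => intro A B a _ _ h; simp [cross] at h
  | @graft Y r G w x h hw hx ih =>
    have hwx : w ≠ x := fun e => hx (e ▸ hw)
    rw [outArc_of_ne hwx]
    set e : Arc X := ⟨w, x, hwx, colorOf w x⟩ with he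
    -- By symmetry the grafted letter `x` may be taken in `A`. If its parent is in `A` too, the cut
    -- comes from the smaller tree. Otherwise the grafted arc is the cut itself, and connectedness
    -- of the smaller tree leaves only `A = {x}`.
    have key : ∀ {A B : Finset X} {a : Arc X}, x ∈ A → A ∪ B = insert x Y → Disjoint A B →
        cross A B ({e} + G) = {a} →
        (a.src ∈ A ∧ a.tgt ∈ B ∧ RootedTree A r (restrict A ({e} + G)) ∧
          RootedTree B a.tgt (restrict B ({e} + G))) ∨
        (a.src ∈ B ∧ a.tgt ∈ A ∧ RootedTree B r (restrict B ({e} + G)) ∧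
          RootedTree A a.tgt (restrict A ({e} + G))) := by
      intro A B a hxA hU hd hc
      have hxB : x ∉ B := Finset.disjoint_left.mp hd hxA
      have hU' : A.erase x ∪ B = Y := by
        rw [← Finset.erase_insert hx, ← hU, Finset.erase_union_distrib, Finset.erase_eq_of_notMem hxB]
      have hd' : Disjoint (A.erase x) B := hd.mono_left (Finset.erase_subset _ _)
      have hsx : ∀ b ∈ G, b.src ≠ x ∧ b.tgt ≠ x := fun b hb =>
        ⟨fun h' => hx (h' ▸ (h.mem b hb).1), fun h' => hx (h' ▸ (h.mem b hb).2.1)⟩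
      have hrG : restrict A G = restrict (A.erase x) G :=
        Multiset.filter_congr fun b hb => by simp [hsx b hb]
      have hcG : cross A B G = cross (A.erase x) B G :=
        Multiset.filter_congr fun b hb => by simp [hsx b hb]
      rw [Multiset.singleton_add] at hc ⊢
      rw [restrict_cons_neg (A := B) (Or.inr hxB)]
      by_cases hwA : w ∈ A
      · rw [cross_cons_left (show e.src ∈ A from hwA) (show e.tgt ∈ A from hxA), hcG] at hc
        rw [restrict_cons_pos (show e.src ∈ A from hwA) (show e.tgt ∈ A from hxA), hrG]
        have hg : ∀ {q}, RootedTree (A.erase x) q (restrict (A.erase x) G) →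
            RootedTree A q (e ::ₘ restrict (A.erase x) G) := fun hq =>
          (hq.graft (w := w) (Finset.mem_erase.mpr ⟨hwx, hwA⟩) (Finset.notMem_erase _ _)).congr
            (Finset.insert_erase hxA) (by rw [outArc_of_ne hwx, Multiset.singleton_add])
        rcases ih hU' hd' hc with ⟨h1, h2, h3, h4⟩ | ⟨h1, h2, h3, h4⟩
        · exact Or.inl ⟨Finset.mem_of_mem_erase h1, h2, hg h3, h4⟩
        · exact Or.inr ⟨h1, Finset.mem_of_mem_erase h2, h3, hg h4⟩
      · have hwB : w ∈ B := by
          have : w ∈ A ∪ B := by rw [hU]; simp [hw]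
          exact (Finset.mem_union.mp this).resolve_left hwA
        rw [cross_cons_pos (Or.inl (show e.src ∉ A from hwA))
          (Or.inr (show e.tgt ∉ B from hxB)), hcG] at hc
        have hca := congrArg Multiset.card hc
        rw [Multiset.card_cons, Multiset.card_singleton, Nat.add_eq_right,
          Multiset.card_eq_zero] at hca
        rw [hca] at hc
        obtain rfl : e = a := by simpa using hc
        have hA' : A.erase x = ∅ := by
          by_contra hne
          obtain ⟨y, hy⟩ := Finset.nonempty_iff_ne_empty.mpr hne
          obtain ⟨b, hb, hb'⟩ := h.exists_boundary (A := A.erase x)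
            ⟨y, by rw [← hU']; exact Finset.mem_union_left _ hy, hy⟩
            ⟨w, hw, fun h' => hwA (Finset.mem_of_mem_erase h')⟩
          have hbm : b ∈ cross (A.erase x) B G := by
            refine Multiset.mem_filter.mpr ⟨hb, fun h' => hb' (iff_of_true h'.1 h'.2), fun h' => ?_⟩
            exact hb' (iff_of_false (Finset.disjoint_right.mp hd' h'.1)
              (Finset.disjoint_right.mp hd' h'.2))
          rw [hca] at hbm
          simp at hbm
        have hA : A = {x} := by rw [← Finset.insert_erase hxA, hA']; rfl
        have hB : B = Y := by rw [← hU', hA', Finset.empty_union]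
        have hrA : restrict A (e ::ₘ G) = 0 := by
          rw [restrict_cons_neg (Or.inl (show e.src ∉ A from hwA)), hrG, hA']
          simp [restrict]
        have hrB : restrict B G = G :=
          Multiset.filter_eq_self.mpr fun b hb => by
            rw [hB]; exact ⟨(h.mem b hb).1, (h.mem b hb).2.1⟩
        refine Or.inr ⟨hwB, hxA, ?_, ?_⟩
        · rw [hrB, hB]; exact h
        · rw [hrA, hA]; exact .point x
    intro A B a hU hd hc
    have hxU : x ∈ A ∪ B := by rw [hU]; simp
    rcases Finset.mem_union.mp hxU with hxA | hxB
    · exact key hxA hU hd hc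
    · rw [cross_comm] at hc
      exact (key hxB (by rw [Finset.union_comm, hU]) hd.symm hc).symm

/-- Every rooted tree with an arc at the root can be cut along this arc. -/
theorem RootedTree.exists_cut {Y : Finset X} {r : X} {G : OGraph X} (h : RootedTree Y r G) :
    ∀ {a : Arc X}, a ∈ G → ∃ A B, A ∪ B = Y ∧ Disjoint A B ∧ cross A B G = {a} ∧
      a.src ∈ A ∧ a.tgt ∈ B := by
  induction h with
  | point r => simp
  | @graft Y r G w x h hw hx ih =>
    have hwx : w ≠ x := fun e => hx (e ▸ hw)
    have hsx : ∀ b ∈ G, b.src ≠ x ∧ b.tgt ≠ x := fun b hb =>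
      ⟨fun h' => hx (h' ▸ (h.mem b hb).1), fun h' => hx (h' ▸ (h.mem b hb).2.1)⟩
    rw [outArc_of_ne hwx]
    set e : Arc X := ⟨w, x, hwx, colorOf w x⟩ with he
    intro a ha
    rw [Multiset.singleton_add, Multiset.mem_cons] at ha
    rw [Multiset.singleton_add]
    rcases ha with rfl | ha
    · refine ⟨Y, {x}, by ext; simp, by simpa using hx, ?_, hw, by simp [he]⟩
      rw [cross_cons_pos (Or.inr (show e.tgt ∉ Y from hx))
        (Or.inl (show e.src ∉ ({x} : Finset X) by simpa using hwx))]
      have : cross Y {x} G = 0 := Multiset.filter_eq_nil.mpr fun b hb h' =>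
        h'.1 ⟨(h.mem b hb).1, (h.mem b hb).2.1⟩
      rw [this]; rfl
    · obtain ⟨A, B, hU, hd, hc, h1, h2⟩ := ih ha
      have hxn : x ∉ A ∪ B := by rw [hU]; exact hx
      rw [Finset.mem_union, not_or] at hxn
      by_cases hwA : w ∈ A
      · refine ⟨insert x A, B, by rw [Finset.insert_union, hU],
          Finset.disjoint_insert_left.mpr ⟨hxn.2, hd⟩, ?_, by simp [h1], h2⟩
        rw [cross_cons_left (by simp [he, hwA]) (by simp [he]), ← hc]
        exact Multiset.filter_congr fun b hb => by simp [hsx b hb]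
      · have hwB : w ∈ B := by
          have : w ∈ A ∪ B := by rw [hU]; simp [hw]
          exact (Finset.mem_union.mp this).resolve_left hwA
        refine ⟨A, insert x B, by rw [Finset.union_insert, hU],
          Finset.disjoint_insert_right.mpr ⟨hxn.1, hd⟩, ?_, h1, by simp [h2]⟩
        rw [cross_cons_right (by simp [he, hwB]) (by simp [he]), ← hc]
        exact Multiset.filter_congr fun b hb => by simp [hsx b hb]

end EilTwo

namespace EilTwo

variable {R : Type*} [CommRing R] {X : Type*} [LinearOrder X]

/-! ### Linear independence of rooted trees -/

theorem RootedTree.root_unique {Y : Finset X} {r r' : X} {G : OGraph X} (h : RootedTree Y r G)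
    (h' : RootedTree Y r' G) : r = r' := by
  by_contra hne
  obtain ⟨a, ha, e⟩ := h'.exists_tgt r h.root_mem hne
  exact (h.mem a ha).2.2.1 e

open Classical in
/-- The kind of the letter `v`: root (`1`), with a smaller parent (`2`), or with a larger parent
(`0`). -/
noncomputable def kind (G : OGraph X) (v : X) : ℕ :=
  if ∃ a ∈ G, a.tgt = v then if ∃ a ∈ G, a.tgt = v ∧ a.src < v then 2 else 0 else 1

open Classical in
theorem kind_congr {G H : OGraph X} {v : X} (h : ∀ a : Arc X, a.tgt = v → (a ∈ G ↔ a ∈ H)) :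
    kind G v = kind H v := by
  have h1 : (∃ a ∈ G, a.tgt = v) ↔ ∃ a ∈ H, a.tgt = v :=
    exists_congr fun a => and_congr_left fun e => h a e
  have h2 : (∃ a ∈ G, a.tgt = v ∧ a.src < v) ↔ ∃ a ∈ H, a.tgt = v ∧ a.src < v :=
    exists_congr fun a => and_congr_left fun e => h a e.1
  exact if_congr h1 (if_congr h2 rfl rfl) rfl

theorem RootedTree.kind_root {Y : Finset X} {r : X} {G : OGraph X} (h : RootedTree Y r G) :
    kind G r = 1 := by
  rw [kind, if_neg]
  rintro ⟨a, ha, e⟩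
  exact (h.mem a ha).2.2.1 e

theorem RootedTree.kind_tgt {Y : Finset X} {r : X} {G : OGraph X} (h : RootedTree Y r G)
    {a : Arc X} (ha : a ∈ G) : kind G a.tgt = if a.src < a.tgt then 2 else 0 := by
  rw [kind, if_pos ⟨a, ha, rfl⟩]
  congr 1
  refine propext ⟨?_, fun h => ⟨a, ha, rfl, h⟩⟩
  rintro ⟨b, hb, e, hlt⟩
  rwa [h.eq_of_tgt b hb a ha e] at hlt

theorem kind_eq_one {G : OGraph X} {v : X} : kind G v = 1 ↔ ∀ a ∈ G, a.tgt ≠ v := by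
  rw [kind]
  split_ifs with h1 h2
  · simpa using h1
  · simpa using h1
  · simpa using h1

/-- The number of arcs at the root. -/
noncomputable def rootDegree (G : OGraph X) : ℕ := (G.filter fun a => kind G a.src = 1).card

theorem RootedTree.rootDegree_eq {Y : Finset X} {r : X} {G : OGraph X} (h : RootedTree Y r G) :
    rootDegree G = (G.filter fun a => a.src = r).card := by
  rw [rootDegree]
  congr 1
  refine Multiset.filter_congr fun a ha => ?_
  rw [kind_eq_one]
  refine ⟨fun h' => ?_, fun h' b hb => ?_⟩
  · by_contra hne
    obtain ⟨b, hb, e⟩ := h.exists_tgt a.src (h.mem a ha).1 hne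
    exact h' b hb e
  · rw [h']; exact (h.mem b hb).2.2.1

/-- The quantity which increases when a rooted tree is cut at the root and the parts are joined
differently. -/
noncomputable def rank (G : OGraph X) : Lex (X → ℕ) ×ₗ ℕᵒᵈ :=
  toLex (toLex (kind G), OrderDual.toDual (rootDegree G))

omit [LinearOrder X] in
theorem Arc.eq_of {a b : Arc X} (h1 : a.src = b.src) (h2 : a.tgt = b.tgt)
    (h3 : a.color = b.color) : a = b := by
  cases a; cases b; simp only at h1 h2 h3; subst h1 h2 h3; rfl

theorem colorOf_eq_iff {u v w x : X} : colorOf u v = colorOf w x ↔ (u < v ↔ w < x) := by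
  unfold colorOf
  by_cases h1 : u < v <;> by_cases h2 : w < x <;> simp [h1, h2]

/-- `G'` glues the two halves of `G` by another arc of the same colour. If this arc leaves `A`, it
enters `a.tgt` from the same side but not from `r`: all kinds agree and the root loses an arc, an
increase in `ℕᵒᵈ`. If it leaves `B`, the root moves from `r` to `a.tgt` and only these two kinds
change. The smaller of the two letters decides: for red it is `r`, going from `1` to `2`; for blue
it is `a.tgt`, going from `0` to `1`. -/
theorem RootedTree.rank_lt [Finite X] {Y A B : Finset X} {r r' : X} {G G' : OGraph X}
    {a a' : Arc X} (h : RootedTree Y r G) (h' : RootedTree Y r' G') (hU : A ∪ B = Y)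
    (hd : Disjoint A B) (hc : cross A B G = {a}) (hc' : cross A B G' = {a'})
    (har : a.src = r) (haA : a.src ∈ A) (hA : restrict A G' = restrict A G)
    (hB : restrict B G' = restrict B G) (hcol : a'.color = a.color) (hne : G' ≠ G) :
    rank G < rank G' := by
  have hG := restrict_add_restrict_add_cross hd G
  have hG' := restrict_add_restrict_add_cross hd G'
  rw [hc] at hG
  rw [hc', hA, hB] at hG'
  have haG : a ∈ G := by rw [← hG]; simp
  have haG' : a' ∈ G' := by rw [← hG']; simp
  have hmem : ∀ b : Arc X, b ≠ a → b ≠ a' → (b ∈ G ↔ b ∈ G') := by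
    intro b h1 h2
    rw [← hG, ← hG']; simp [h1, h2]
  have hcolor : a'.src < a'.tgt ↔ a.src < a.tgt := by
    rw [(h.mem a haG).2.2.2, (h'.mem a' haG').2.2.2, colorOf_eq_iff] at hcol
    exact hcol
  obtain ⟨-, -, hPA, hQB⟩ := (h.cut hU hd hc).resolve_right
    fun e => Finset.disjoint_left.mp hd haA e.1
  rcases h'.cut hU hd hc' with ⟨-, -, hPA', hQB'⟩ | ⟨-, -, hQB', hPA'⟩
  · rw [hA] at hPA'
    rw [hB] at hQB'
    have hr := hPA.root_unique hPA'
    have hs := hQB.root_unique hQB'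
    subst hr
    have hsrc : a'.src ≠ r := by
      intro e
      refine hne ?_
      rw [← hG, ← hG', Arc.eq_of (e.trans har.symm) hs.symm hcol]
    have hk : kind G = kind G' := by
      funext v
      by_cases hv : v = a.tgt
      · rw [hv, h.kind_tgt haG]
        conv_rhs => rw [hs, h'.kind_tgt haG']
        exact if_congr hcolor.symm rfl rfl
      · refine kind_congr fun b hb => hmem b ?_ ?_
        · rintro rfl; exact hv hb.symm
        · rintro rfl; exact hv (by rw [hs, hb])
    rw [rank, rank, hk, Prod.Lex.toLex_lt_toLex]
    refine Or.inr ⟨rfl, ?_⟩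
    rw [OrderDual.toDual_lt_toDual, h.rootDegree_eq, h'.rootDegree_eq, ← hG, ← hG']
    simp [Multiset.filter_singleton, har, hsrc]
  · rw [hA] at hPA'
    rw [hB] at hQB'
    have hr := hPA.root_unique hPA'
    have hs := hQB.root_unique hQB'
    subst hs
    have hother : ∀ v, v ≠ r → v ≠ a.tgt → kind G v = kind G' v := by
      intro v h1 h2
      refine kind_congr fun b hb => hmem b ?_ ?_
      · rintro rfl; exact h2 hb.symm
      · rintro rfl; exact h1 (by rw [hr, hb])
    have k1 := h.kind_root
    have k2 := h.kind_tgt haG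
    have k3 := h'.kind_root
    have k4 := h'.kind_tgt haG'
    rw [← hr] at k4 hcolor
    rw [har] at k2 hcolor
    rw [rank, rank, Prod.Lex.toLex_lt_toLex]
    left
    have hrs : r ≠ a.tgt := har ▸ a.ne
    rcases hrs.lt_or_gt with hlt | hgt
    · refine ⟨r, fun j hj => hother j hj.ne (hj.trans hlt).ne, ?_⟩
      show kind G r < kind G' r
      rw [k1, k4, if_pos (hcolor.mpr hlt)]; norm_num
    · refine ⟨a.tgt, fun j hj => hother j (hj.trans hgt).ne hj.ne, ?_⟩
      show kind G a.tgt < kind G' a.tgt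
      rw [k2, k3, if_neg hgt.not_gt]; norm_num

open BinTree in
/-- A combination of rooted trees whose pairings with all binary trees vanish is zero. -/
theorem eq_zero_of_functional_eq_zero [Finite X] (Y : Finset X) :
    ∀ x : Gam R X, (∀ G ∈ x.support, ∃ r, RootedTree Y r G) →
      (∀ T : BinTree X, T.Valid → T.leaves = Y → T.functional R x = 0) → x = 0 := by
  classical
  induction hcard : Y.card using Nat.strong_induction_on generalizing Y with
  | _ n ihn =>
  subst hcard
  intro x hsupp hT
  by_contra hx
  obtain ⟨G, hGx, hmax⟩ := Finset.exists_max_image x.support rank (Finsupp.support_nonempty_iff.mpr hx)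
  obtain ⟨r, hG⟩ := hsupp G hGx
  have hxG : x G ≠ 0 := Finsupp.mem_support_iff.mp hGx
  by_cases hr : ∃ a ∈ G, a.src = r
  swap
  · have hY : Y = {r} := by
      refine Finset.eq_singleton_iff_unique_mem.mpr ⟨hG.root_mem, fun z hz => ?_⟩
      by_contra hzr
      obtain ⟨a, ha, h'⟩ := hG.exists_boundary (A := {r}) ⟨r, hG.root_mem, by simp⟩
        ⟨z, hz, by simpa using hzr⟩
      refine h' (iff_of_false (fun h => hr ⟨a, ha, by simpa using h⟩) ?_)
      simpa using (hG.mem a ha).2.2.1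
    have h0 : ∀ G' ∈ x.support, G' = 0 := by
      intro G' hG'
      obtain ⟨r', h'⟩ := hsupp G' hG'
      refine Multiset.eq_zero_of_forall_notMem fun a ha => a.ne ?_
      have h1 := (h'.mem a ha).1
      have h2 := (h'.mem a ha).2.1
      rw [hY, Finset.mem_singleton] at h1 h2
      rw [h1, h2]
    have h := hT (leaf r) trivial hY.symm
    rw [functional_apply, Finsupp.sum, Finset.sum_eq_single G] at h
    · rw [h0 G hGx] at h hxG
      exact hxG (by simpa [pairing] using h)
    · intro G' hG' hne
      exact absurd ((h0 G' hG').trans (h0 G hGx).symm) hne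
    · intro h'; exact absurd hGx h'
  obtain ⟨a, haG, har⟩ := hr
  obtain ⟨A, B, hU, hd, hc, haA, haB⟩ := hG.exists_cut haG
  have hcA : A.card < Y.card := by
    rw [← hU, Finset.card_union_of_disjoint hd]
    have := Finset.card_pos.mpr ⟨_, haB⟩
    omega
  have hcB : B.card < Y.card := by
    rw [← hU, Finset.card_union_of_disjoint hd]
    have := Finset.card_pos.mpr ⟨_, haA⟩
    omega
  set w : OGraph X → R := fun G' => (crossSign a.color A (cross A B G') : R) with hw
  have hw0 : ∀ G', w G' ≠ 0 → ∃ a', cross A B G' = {a'} ∧ a'.color = a.color := by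
    intro G' h
    have h1 : crossSign a.color A (cross A B G') ≠ 0 := fun h0 => h (by simp [hw, h0])
    obtain ⟨a', ha'⟩ := exists_cross_eq_singleton h1
    refine ⟨a', ha', ?_⟩
    by_contra hne
    exact h1 (by simp [ha', crossSign, arcSign, hne])
  -- The functionals of `node a.color S T` give vanishing sums of products of a pairing on `A` with
  -- one on `B`. With `T` fixed, induction on `A` isolates each restriction to `A`; `hstepB` then
  -- does the same on `B`.
  have hstepA : ∀ T : BinTree X, T.Valid → T.leaves = B → ∀ P : OGraph X,
      ∑ G' ∈ x.support, (if restrict A G' = P then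
        x G' * w G' * (T.pairing (restrict B G') : R) else 0) = 0 := by
    intro T hTv hTB P
    set y : Gam R X := ∑ G' ∈ x.support,
      Finsupp.single (restrict A G') (x G' * w G' * (T.pairing (restrict B G') : R)) with hy
    have hy0 : y = 0 := by
      refine ihn _ hcA A rfl y (fun P hP => ?_) fun S hS hSA => ?_
      · obtain ⟨G', hG', hP'⟩ := Finsupp.mem_support_finsetSum _ hP
        obtain ⟨rfl, hne⟩ := Finsupp.mem_support_single _ _ _ |>.mp hP'
        obtain ⟨a', ha', -⟩ := hw0 G' fun h0 => hne (by rw [h0]; ring)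
        obtain ⟨r', hr'⟩ := hsupp G' hG'
        rcases hr'.cut hU hd ha' with ⟨-, -, h, -⟩ | ⟨-, -, -, h⟩
        · exact ⟨_, h⟩
        · exact ⟨_, h⟩
      · have h := hT (node a.color S T) ⟨hS, hTv, by rw [hSA, hTB]; exact hd⟩
          (by rw [leaves, hSA, hTB, hU])
        rw [functional_apply, Finsupp.sum] at h
        rw [hy, map_sum, ← h]
        refine Finset.sum_congr rfl fun G' _ => ?_
        rw [functional, Finsupp.linearCombination_single, pairing, hSA, hTB, smul_eq_mul]
        push_cast
        ring
    have := congrArg (fun z : Gam R X => z P) hy0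
    simp only [hy, Finsupp.finsetSum_apply, Finsupp.single_apply] at this
    exact this
  have hstepB : ∀ P Q : OGraph X,
      ∑ G' ∈ x.support, (if restrict A G' = P ∧ restrict B G' = Q then x G' * w G' else 0) = 0 := by
    intro P Q
    set y : Gam R X := ∑ G' ∈ x.support,
      Finsupp.single (restrict B G') (if restrict A G' = P then x G' * w G' else 0) with hy
    have hy0 : y = 0 := by
      refine ihn _ hcB B rfl y (fun Q hQ => ?_) fun S hS hSB => ?_
      · obtain ⟨G', hG', hQ'⟩ := Finsupp.mem_support_finsetSum _ hQ
        obtain ⟨rfl, hne⟩ := Finsupp.mem_support_single _ _ _ |>.mp hQ'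
        obtain ⟨a', ha', -⟩ := hw0 G' fun h0 => hne (by simp [h0])
        obtain ⟨r', hr'⟩ := hsupp G' hG'
        rcases hr'.cut hU hd ha' with ⟨-, -, -, h⟩ | ⟨-, -, h, -⟩
        · exact ⟨_, h⟩
        · exact ⟨_, h⟩
      · rw [hy, map_sum]
        refine Eq.trans (Finset.sum_congr rfl fun G' _ => ?_) (hstepA S hS hSB P)
        rw [functional, Finsupp.linearCombination_single, smul_eq_mul, ite_mul, zero_mul]
    have := congrArg (fun z : Gam R X => z Q) hy0
    simp only [hy, Finsupp.finsetSum_apply, Finsupp.single_apply, Finsupp.zero_apply] at this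
    refine Eq.trans (Finset.sum_congr rfl fun G' _ => ?_) this
    by_cases h1 : restrict A G' = P <;> by_cases h2 : restrict B G' = Q <;> simp [h1, h2]
  have h := hstepB (restrict A G) (restrict B G)
  rw [Finset.sum_eq_single G] at h
  · have hwG : w G = 1 := by simp [hw, hc, crossSign, arcSign, haA]
    rw [if_pos ⟨rfl, rfl⟩, hwG, mul_one] at h
    exact hxG h
  · intro G' hG' hne
    -- A tree `G'` with the same halves and nonzero weight would beat the maximal rank of `G`.
    by_cases hPQ : restrict A G' = restrict A G ∧ restrict B G' = restrict B G
    swap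
    · rw [if_neg hPQ]
    rw [if_pos hPQ]
    by_cases hwG : w G' = 0
    · rw [hwG, mul_zero]
    obtain ⟨a', ha', hcol⟩ := hw0 G' hwG
    obtain ⟨r', hr'⟩ := hsupp G' hG'
    exact absurd (hmax G' hG')
      (not_le.mpr (hG.rank_lt hr' hU hd hc ha' har haA hPQ.1 hPQ.2 hcol hne))
  · intro h'; exact absurd hGx h'

end EilTwo

/-! ### Enumeration, and rooted trees as pattern-avoiding trees -/

namespace EilTwo

variable {X : Type*}

/-! ### The number of rooted trees -/

/-- The letter `s` is reached from `w` by passing to parents. -/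
def IsAncestor (f : X → Option X) (s w : X) : Prop :=
  Relation.ReflTransGen (fun a b => f a = some b) w s

/-- The parent function `f` of a rooted forest has no cycles. -/
def Acyclic (f : X → Option X) : Prop := WellFounded fun u v => f v = some u

theorem Acyclic.exists_root {f : X → Option X} (hf : Acyclic f) (w : X) :
    ∃ s, f s = none ∧ IsAncestor f s w ∧ ∀ t, f t = none → IsAncestor f t w → t = s := by
  induction w using hf.induction with
  | _ w ih =>
  cases hw : f w with
  | none =>
    refine ⟨w, hw, .refl, fun t _ h => ?_⟩
    rcases Relation.ReflTransGen.cases_head h with rfl | ⟨c, hc, -⟩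
    · rfl
    · rw [hw] at hc; cases hc
  | some u =>
    obtain ⟨s, h1, h2, h3⟩ := ih u hw
    refine ⟨s, h1, .head hw h2, fun t ht h => ?_⟩
    rcases Relation.ReflTransGen.cases_head h with rfl | ⟨c, hc, h'⟩
    · rw [ht] at hw; cases hw
    · rw [hw] at hc; cases hc; exact h3 t ht h'

variable [DecidableEq X]

theorem Acyclic.update_none {f : X → Option X} (hf : Acyclic f) (s : X) :
    Acyclic (Function.update f s none) := by
  refine Subrelation.wf (fun {u v} h => ?_) hf
  by_cases hv : v = s
  · subst hv; simp at h
  · simpa [hv] using h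

theorem Acyclic.not_isAncestor {f : X → Option X} (hf : Acyclic f) {s w : X} (h : f s = some w) :
    ¬ IsAncestor (Function.update f s none) s w := by
  intro ha
  have hmono : Relation.ReflTransGen (fun a b => f a = some b) w s := by
    refine Relation.ReflTransGen.mono (fun a b hab => ?_) _ _ ha
    by_cases hv : a = s
    · subst hv; simp at hab
    · simpa [hv] using hab
  have hT : Relation.TransGen (fun a b => f a = some b) s s := .head' h hmono
  exact (hf.transGen.irrefl.irrefl s) (Relation.transGen_swap.mpr hT)

/-- Letters that do not reach `s` have unchanged ancestors and stay accessible. The new parent `w`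
of `s` is one of them, so `s` is accessible, and then every letter is. -/
theorem Acyclic.update_some {f : X → Option X} (hf : Acyclic f) {s w : X}
    (h : ¬ IsAncestor f s w) : Acyclic (Function.update f s (some w)) := by
  set g := Function.update f s (some w) with hg
  have h1 : ∀ v, ¬ IsAncestor f s v → Acc (fun u v => g v = some u) v := by
    intro v
    induction v using hf.induction with
    | _ v ih =>
    intro hv
    have hvs : v ≠ s := by rintro rfl; exact hv .refl
    refine ⟨_, fun u hu => ?_⟩
    have hu' : f v = some u := by simpa [hg, hvs] using hu
    exact ih u hu' fun h' => hv (.head hu' h')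
  refine ⟨fun v => ?_⟩
  induction v using hf.induction with
  | _ v ih =>
  refine ⟨_, fun u hu => ?_⟩
  by_cases hvs : v = s
  · subst hvs
    have : w = u := by simpa [hg] using hu
    exact this ▸ h1 w h
  · exact ih u (by simpa [hg, hvs] using hu)

section Count

open Classical

variable (X) [Fintype X]

/-- The rooted forests with `k` roots. -/
noncomputable def forests (k : ℕ) : Finset (X → Option X) :=
  Finset.univ.filter fun f => Acyclic f ∧ (Finset.univ.filter fun v => f v = none).card = k

/-- Double counting of forests with a marked arc. Deleting the arc from `w` to `s` makes `s` a new
root, in a tree not containing `w`. Conversely, in a forest with `k + 1` roots `w` is arbitrary and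
`s` is one of the `k` roots of the trees not containing `w`. -/
theorem card_forests_succ (k : ℕ) :
    (forests X k).card * (Fintype.card X - k) = (forests X (k + 1)).card * (Fintype.card X * k) := by
  have h1 : ((forests X k).sigma fun f => Finset.univ.filter fun s => f s ≠ none).card =
      (forests X k).card * (Fintype.card X - k) := by
    rw [Finset.card_sigma, Finset.sum_const_nat fun f hf => ?_]
    rw [forests, Finset.mem_filter] at hf
    rw [← hf.2.2, Finset.filter_not, Finset.card_sdiff_of_subset (Finset.filter_subset _ _),
      Finset.card_univ]
  have h2 : ((forests X (k + 1)).sigma fun f => Finset.univ.sigma fun w : X =>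
      Finset.univ.filter fun s : X => f s = none ∧ ¬ IsAncestor f s w).card =
      (forests X (k + 1)).card * (Fintype.card X * k) := by
    rw [Finset.card_sigma, Finset.sum_const_nat fun f hf => ?_]
    rw [forests, Finset.mem_filter] at hf
    rw [Finset.card_sigma, Finset.sum_const_nat (m := k) fun w _ => ?_, Finset.card_univ]
    obtain ⟨s, hs, hsw, hu⟩ := hf.2.1.exists_root w
    have : (Finset.univ.filter fun s : X => f s = none ∧ ¬ IsAncestor f s w) =
        (Finset.univ.filter fun s : X => f s = none).erase s := by
      ext t
      simp only [Finset.mem_filter, Finset.mem_univ, true_and, Finset.mem_erase]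
      constructor
      · rintro ⟨h1, h2⟩; exact ⟨fun e => h2 (e ▸ hsw), h1⟩
      · rintro ⟨h1, h2⟩; exact ⟨h2, fun h => h1 (hu t h2 h)⟩
    rw [this, Finset.card_erase_of_mem (by simp [hs]), hf.2.2, Nat.add_sub_cancel]
  rw [← h1, ← h2]
  refine Finset.card_bij' (fun p hp => ⟨Function.update p.1 p.2 none,
      (p.1 p.2).get (Option.ne_none_iff_isSome.mp (by simpa using (Finset.mem_sigma.mp hp).2)), p.2⟩)
    (fun q _ => ⟨Function.update q.1 q.2.2 (some q.2.1), q.2.2⟩) ?_ ?_ ?_ ?_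
  · rintro ⟨f, s⟩ hp
    obtain ⟨hf, hs⟩ := Finset.mem_sigma.mp hp
    simp only [forests, Finset.mem_filter, Finset.mem_univ, true_and] at hf hs
    obtain ⟨w, hw⟩ := Option.ne_none_iff_exists'.mp hs
    simp only [Finset.mem_sigma, forests, Finset.mem_filter, Finset.mem_univ, true_and]
    refine ⟨⟨hf.1.update_none s, ?_⟩, by simp, ?_⟩
    · have : (Finset.univ.filter fun v => Function.update f s none v = none) =
          insert s (Finset.univ.filter fun v => f v = none) := by
        ext v; by_cases hv : v = s <;> simp [hv]
      rw [this, Finset.card_insert_of_notMem (by simp [hw]), hf.2]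
    · refine hf.1.not_isAncestor ?_
      simp
  · rintro ⟨f, w, s⟩ hq
    simp only [Finset.mem_sigma, forests, Finset.mem_filter, Finset.mem_univ, true_and] at hq ⊢
    obtain ⟨⟨hf, hk⟩, hs, hn⟩ := hq
    refine ⟨⟨hf.update_some hn, ?_⟩, by simp⟩
    have : (Finset.univ.filter fun v => Function.update f s (some w) v = none) =
        (Finset.univ.filter fun v => f v = none).erase s := by
      ext v; by_cases hv : v = s <;> simp [hv]
    rw [this, Finset.card_erase_of_mem (by simp [hs]), hk, Nat.add_sub_cancel]
  · rintro ⟨f, s⟩ hp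
    simp
  · rintro ⟨f, w, s⟩ hq
    simp only [Finset.mem_sigma, Finset.mem_filter, Finset.mem_univ, true_and] at hq
    have : Function.update f s none = f := by
      rw [← hq.2.1]; exact Function.update_eq_self s f
    simp [this]

theorem card_forests_card : (forests X (Fintype.card X)).card = 1 := by
  rw [Finset.card_eq_one]
  refine ⟨fun _ => none, ?_⟩
  ext f
  simp only [forests, Finset.mem_filter, Finset.mem_univ, true_and, Finset.mem_singleton]
  constructor
  · rintro ⟨-, h⟩
    rw [← Finset.card_univ, Finset.card_filter_eq_iff] at h
    funext v
    exact h v (Finset.mem_univ v)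
  · rintro rfl
    refine ⟨⟨fun v => ⟨_, fun u hu => by cases hu⟩⟩, by simp⟩

/-- There are `n ^ (n - 1)` rooted trees on `n` letters. -/
theorem card_forests_one (h : 1 ≤ Fintype.card X) :
    (forests X 1).card = Fintype.card X ^ (Fintype.card X - 1) := by
  set n := Fintype.card X with hn
  -- The recursion iterated `j` times. For `j = n - 1` only the forest without arcs is left, and `(n
  -- - 1)!` cancels.
  have key : ∀ j, j ≤ n - 1 → (forests X 1).card * (n - 1).descFactorial j =
      (forests X (1 + j)).card * (n ^ j * j.factorial) := by
    intro j
    induction j with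
    | zero => simp
    | succ j ih =>
      intro hj
      have h2 := card_forests_succ X (1 + j)
      rw [← hn] at h2
      rw [Nat.descFactorial_succ, mul_left_comm, ih (by omega), Nat.sub_sub, mul_left_comm,
        ← mul_assoc, h2, Nat.factorial_succ, pow_succ, add_assoc]
      ring
  have h3 := key (n - 1) le_rfl
  rw [Nat.descFactorial_self, Nat.add_sub_cancel' h, card_forests_card, one_mul] at h3
  exact Nat.eq_of_mul_eq_mul_right (Nat.factorial_pos _) h3

end Count
end EilTwo

namespace EilTwo

variable {X : Type*} [LinearOrder X]

/-! ### Parent functions of rooted trees -/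

/-- The arc from the parent of `v` to `v`. -/
def parentArc (f : X → Option X) (v : X) : OGraph X := (f v).elim 0 fun u => outArc u v

theorem mem_sum_parentArc {f : X → Option X} {Y : Finset X} {a : Arc X} :
    a ∈ ∑ v ∈ Y, parentArc f v ↔
      a.tgt ∈ Y ∧ f a.tgt = some a.src ∧ a.color = colorOf a.src a.tgt := by
  rw [Multiset.mem_sum]
  constructor
  · rintro ⟨v, hv, ha⟩
    cases hf : f v with
    | none => simp [parentArc, hf] at ha
    | some u =>
      rw [parentArc, hf, Option.elim_some, mem_outArc] at ha
      obtain ⟨rfl, rfl, hc⟩ := ha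
      exact ⟨hv, hf, hc⟩
  · rintro ⟨hv, hf, hc⟩
    refine ⟨a.tgt, hv, ?_⟩
    rw [parentArc, hf, Option.elim_some, mem_outArc]
    exact ⟨rfl, rfl, hc⟩

omit [LinearOrder X] in
theorem Acyclic.ne {f : X → Option X} (hf : Acyclic f) {u v : X} (h : f v = some u) : u ≠ v := by
  rintro rfl
  exact hf.irrefl.irrefl u h

theorem Acyclic.rootedTree [Fintype X] {f : X → Option X} (hf : Acyclic f) {r : X}
    (hr : ∀ v, f v = none ↔ v = r) : RootedTree Finset.univ r (∑ v, parentArc f v) := by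
  have key : ∀ k : ℕ, ∃ Y : Finset X, RootedTree Y r (∑ v ∈ Y, parentArc f v) ∧
      (Y = Finset.univ ∨ k < Y.card) := by
    intro k
    induction k with
    | zero =>
      refine ⟨{r}, ?_, by simp⟩
      rw [Finset.sum_singleton, parentArc, (hr r).mpr rfl]
      exact .point r
    | succ k ih =>
      obtain ⟨Y, hY, hk⟩ := ih
      by_cases hu : Y = Finset.univ
      · exact ⟨Y, hY, Or.inl hu⟩
      have hne : {z | z ∉ Y}.Nonempty := by
        by_contra h
        exact hu (Finset.eq_univ_iff_forall.mpr fun z => by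
          by_contra hz; exact h ⟨z, hz⟩)
      -- A letter outside `Y` that is minimal for the parent relation has its parent in `Y`, so it
      -- can be grafted next.
      obtain ⟨z, hz, hmin⟩ := hf.has_min _ hne
      have hzr : z ≠ r := fun e => hz (e ▸ hY.root_mem)
      obtain ⟨u, hzu⟩ := Option.ne_none_iff_exists'.mp (mt (hr z).mp hzr)
      have huY : u ∈ Y := by
        by_contra h; exact hmin u h hzu
      refine ⟨insert z Y, ?_, Or.inr ?_⟩
      · rw [Finset.sum_insert hz]
        have : parentArc f z = outArc u z := by rw [parentArc, hzu, Option.elim_some]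
        rw [this]
        exact hY.graft huY hz
      · rw [Finset.card_insert_of_notMem hz]
        have := hk.resolve_left hu
        omega
  obtain ⟨Y, hY, hk⟩ := key (Fintype.card X)
  have : Y = Finset.univ := hk.resolve_right (not_lt.mpr (Finset.card_le_univ Y))
  exact this ▸ hY

theorem RootedTree.exists_acyclic {Y : Finset X} {r : X} {G : OGraph X} (h : RootedTree Y r G) :
    ∃ f : X → Option X, Acyclic f ∧ (∀ v, f v = none ↔ v ∉ Y ∨ v = r) ∧
      (∀ u v, f v = some u → u ∈ Y) ∧ G = ∑ v ∈ Y, parentArc f v := by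
  induction h with
  | point r =>
    exact ⟨fun _ => none, ⟨fun v => ⟨_, fun u hu => by cases hu⟩⟩,
      fun v => by simp [em'], by simp, by simp [parentArc]⟩
  | @graft Y r G w x h hw hx ih =>
    obtain ⟨f, hf, h1, h2, rfl⟩ := ih
    have hwx : w ≠ x := fun e => hx (e ▸ hw)
    have hfx : f x = none := (h1 x).mpr (Or.inl hx)
    have hxr : x ≠ r := fun e => hx (e ▸ h.root_mem)
    refine ⟨Function.update f x (some w), hf.update_some fun ha => ?_, fun v => ?_, fun u v hv => ?_,
      ?_⟩
    · rcases Relation.ReflTransGen.cases_tail ha with e | ⟨c, -, hc⟩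
      · exact hwx e.symm
      · exact hx (h2 _ _ hc)
    · by_cases hv : v = x
      · subst hv; simp [hxr]
      · simp [hv, h1]
    · by_cases hvx : v = x
      · subst hvx
        obtain rfl : w = u := by simpa using hv
        simp [hw]
      · exact Finset.mem_insert_of_mem (h2 u v (by simpa [hvx] using hv))
    · rw [Finset.sum_insert hx, parentArc, Function.update_self, Option.elim_some]
      congr 1
      refine Finset.sum_congr rfl fun v hv => ?_
      have hvx : v ≠ x := fun e => hx (e ▸ hv)
      rw [parentArc, parentArc, Function.update_of_ne hvx]

theorem ncard_rootedTrees [Fintype X] (h : 1 ≤ Fintype.card X) :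
    {G : OGraph X | ∃ r, RootedTree Finset.univ r G}.ncard =
      Fintype.card X ^ (Fintype.card X - 1) := by
  classical
  have hset : {G : OGraph X | ∃ r, RootedTree Finset.univ r G} =
      (fun f => ∑ v, parentArc f v) '' (forests X 1 : Set (X → Option X)) := by
    ext G
    simp only [Set.mem_ofPred_eq, Set.mem_image, Finset.mem_coe, forests, Finset.mem_filter,
      Finset.mem_univ, true_and]
    constructor
    · rintro ⟨r, hr⟩
      obtain ⟨f, hf, h1, -, rfl⟩ := hr.exists_acyclic
      refine ⟨f, ⟨hf, Finset.card_eq_one.mpr ⟨r, ?_⟩⟩, rfl⟩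
      ext v; simp [h1]
    · rintro ⟨f, ⟨hf, h1⟩, rfl⟩
      obtain ⟨r, hr⟩ := Finset.card_eq_one.mp h1
      refine ⟨r, hf.rootedTree fun v => ?_⟩
      have := Finset.ext_iff.mp hr v
      simpa using this
  rw [hset, Set.InjOn.ncard_image, Set.ncard_coe_finset]
  · convert card_forests_one X h
  · intro f hf g hg hfg
    simp only [Finset.mem_coe, forests, Finset.mem_filter, Finset.mem_univ, true_and] at hf hg
    have key : ∀ {f g : X → Option X}, Acyclic f →
        ∑ v, parentArc f v = ∑ v, parentArc g v → ∀ u v, f v = some u → g v = some u := by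
      intro f g hf hfg u v hv
      have hm : (⟨u, v, hf.ne hv, colorOf u v⟩ : Arc X) ∈ ∑ v, parentArc f v :=
        mem_sum_parentArc.mpr ⟨Finset.mem_univ _, hv, rfl⟩
      rw [hfg] at hm
      exact (mem_sum_parentArc.mp hm).2.1
    funext v
    refine Option.ext fun u => ?_
    exact ⟨key hf.1 hfg u v, key hg.1 hfg.symm u v⟩

/-! ### Oriented copies of pattern-avoiding trees are rooted trees -/

theorem Edge.orient_red (e : Edge X) (h : e.color = .red) :
    e.orient = ⟨e.lo, e.hi, e.lt.ne, .red⟩ := by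
  rcases e with ⟨lo, hi, lt, c⟩; simp only at h; subst h; rfl

theorem Edge.orient_blue (e : Edge X) (h : e.color = .blue) :
    e.orient = ⟨e.hi, e.lo, e.lt.ne', .blue⟩ := by
  rcases e with ⟨lo, hi, lt, c⟩; simp only at h; subst h; rfl

theorem Edge.orient_color (e : Edge X) : e.orient.color = colorOf e.orient.src e.orient.tgt := by
  rcases e with ⟨lo, hi, lt, c⟩
  cases c
  · exact (colorOf_red lt).symm
  · exact (colorOf_blue lt).symm

theorem Edge.orient_joins (e : Edge X) : e.orient.Joins e.lo e.hi := by
  rcases e with ⟨lo, hi, lt, c⟩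
  cases c
  · exact Or.inl ⟨rfl, rfl⟩
  · exact Or.inr ⟨rfl, rfl⟩

/-- The edge underlying an arc. -/
def Arc.toEdge (a : Arc X) : Edge X :=
  ⟨min a.src a.tgt, max a.src a.tgt, min_lt_max.mpr a.ne, a.color⟩

theorem Arc.orient_toEdge {a : Arc X} (h : a.color = colorOf a.src a.tgt) :
    a.toEdge.orient = a := by
  rcases a with ⟨s, t, hst, c⟩
  simp only at h
  rcases hst.lt_or_gt with hlt | hlt
  · rw [colorOf_red hlt] at h; subst h
    rw [Edge.orient_red _ rfl]
    simp [Arc.toEdge, hlt.le]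
  · rw [colorOf_blue hlt] at h; subst h
    rw [Edge.orient_blue _ rfl]
    simp [Arc.toEdge, hlt.le]

theorem Graph.toSimpleGraph_orientedCopy (U : Graph X) :
    U.orientedCopy.toSimpleGraph = U.toSimpleGraph := by
  ext u v
  rw [OGraph.adj_iff, Graph.toSimpleGraph, SimpleGraph.fromRel_adj]
  simp only [Graph.orientedCopy, Multiset.mem_map]
  constructor
  · rintro ⟨_, ⟨e, he, rfl⟩, hj⟩
    refine ⟨hj.ne, ?_⟩
    rcases e.orient_joins with ⟨h1, h2⟩ | ⟨h1, h2⟩ <;> rcases hj with ⟨h3, h4⟩ | ⟨h3, h4⟩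
    · exact Or.inl ⟨e, he, h1.symm.trans h3, h2.symm.trans h4⟩
    · exact Or.inr ⟨e, he, h1.symm.trans h3, h2.symm.trans h4⟩
    · exact Or.inr ⟨e, he, h2.symm.trans h4, h1.symm.trans h3⟩
    · exact Or.inl ⟨e, he, h2.symm.trans h4, h1.symm.trans h3⟩
  · rintro ⟨-, ⟨e, he, rfl, rfl⟩ | ⟨e, he, rfl, rfl⟩⟩
    · exact ⟨_, ⟨e, he, rfl⟩, e.orient_joins⟩
    · exact ⟨_, ⟨e, he, rfl⟩, e.orient_joins.symm⟩

namespace RootedTree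

theorem card_add_one {Y : Finset X} {r : X} {G : OGraph X} (h : RootedTree Y r G) :
    G.card + 1 = Y.card := by
  induction h with
  | point r => simp
  | @graft Y r G w x h hw hx ih =>
    have hwx : w ≠ x := fun e => hx (e ▸ hw)
    rw [outArc_of_ne hwx, Finset.card_insert_of_notMem hx, ← ih, Multiset.singleton_add,
      Multiset.card_cons]

theorem reachable {Y : Finset X} {r : X} {G : OGraph X} (h : RootedTree Y r G) :
    ∀ {H : OGraph X}, G ≤ H → ∀ y ∈ Y, H.toSimpleGraph.Reachable r y := by
  induction h with
  | point r => intro H _ y hy; rw [Finset.mem_singleton.mp hy]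
  | @graft Y r G w x h hw hx ih =>
    have hwx : w ≠ x := fun e => hx (e ▸ hw)
    rw [outArc_of_ne hwx]
    intro H hH y hy
    have hG : G ≤ H := (Multiset.le_add_left _ _).trans hH
    rcases Finset.mem_insert.mp hy with rfl | hy
    · refine (ih hG w hw).trans (SimpleGraph.Adj.reachable (OGraph.adj_iff.mpr ?_))
      exact ⟨⟨w, y, hwx, colorOf w y⟩, Multiset.mem_of_le hH (by simp), Or.inl ⟨rfl, rfl⟩⟩
    · exact ih hG y hy

theorem nodup_edges {Y : Finset X} {r : X} {G : OGraph X} (h : RootedTree Y r G) :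
    (G.map fun a => (min a.src a.tgt, max a.src a.tgt)).Nodup := by
  induction h with
  | point r => simp
  | @graft Y r G w x h hw hx ih =>
    have hwx : w ≠ x := fun e => hx (e ▸ hw)
    rw [outArc_of_ne hwx, Multiset.singleton_add, Multiset.map_cons, Multiset.nodup_cons]
    refine ⟨fun hm => ?_, ih⟩
    obtain ⟨b, hb, e⟩ := Multiset.mem_map.mp hm
    obtain ⟨h1, h2, -⟩ := h.mem b hb
    have hb1 : b.src ≠ x := fun e => hx (e ▸ h1)
    have hb2 : b.tgt ≠ x := fun e => hx (e ▸ h2)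
    simp only [Prod.mk.injEq] at e
    rcases le_total w x with hle | hle
    · rw [max_eq_right hle] at e
      rcases max_choice b.src b.tgt with h' | h' <;> rw [h'] at e
      · exact hb1 e.2
      · exact hb2 e.2
    · rw [min_eq_right hle] at e
      rcases min_choice b.src b.tgt with h' | h' <;> rw [h'] at e
      · exact hb1 e.1
      · exact hb2 e.1

/-- Acyclicity follows from connectedness by counting: there is one arc fewer than there are
letters. -/
theorem isTree [Fintype X] {r : X} {G : OGraph X} (h : RootedTree Finset.univ r G) :
    G.toSimpleGraph.IsTree := by
  classical
  have hc : G.toSimpleGraph.Connected :=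
    { preconnected := fun x y => (h.reachable le_rfl x (Finset.mem_univ x)).symm.trans
        (h.reachable le_rfl y (Finset.mem_univ y))
      nonempty := ⟨r⟩ }
  refine SimpleGraph.isTree_iff_connected_and_card.mpr ⟨hc, le_antisymm ?_
    hc.card_vert_le_card_edgeSet_add_one⟩
  have h1 := h.card_add_one
  rw [Finset.card_univ] at h1
  rw [Nat.card_eq_fintype_card (α := X), ← h1]
  refine Nat.add_le_add_right ?_ 1
  have hsub : G.toSimpleGraph.edgeSet ⊆ ((G.map fun a => s(a.src, a.tgt)).toFinset : Set (Sym2 X)) := by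
    intro e
    induction e with
    | _ u v =>
    rw [SimpleGraph.mem_edgeSet, OGraph.adj_iff]
    rintro ⟨a, ha, hj⟩
    rw [Finset.mem_coe, Multiset.mem_toFinset, Multiset.mem_map]
    refine ⟨a, ha, ?_⟩
    rcases hj with ⟨rfl, rfl⟩ | ⟨rfl, rfl⟩
    · rfl
    · exact Sym2.eq_swap
  calc Nat.card G.toSimpleGraph.edgeSet
      ≤ ((G.map fun a => s(a.src, a.tgt)).toFinset : Set (Sym2 X)).ncard :=
        Set.ncard_le_ncard hsub (Finset.finite_toSet _)
    _ ≤ G.card := by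
        rw [Set.ncard_coe_finset]
        exact (Multiset.toFinset_card_le _).trans (Multiset.card_map _ _).le

theorem mem_orientedTrees [Fintype X] {r : X} {G : OGraph X} (h : RootedTree Finset.univ r G) :
    G ∈ orientedTrees X := by
  set U : Graph X := G.map Arc.toEdge with hU
  have hUG : U.orientedCopy = G := by
    rw [Graph.orientedCopy, hU, Multiset.map_map]
    conv_rhs => rw [← Multiset.map_id' G]
    exact Multiset.map_congr rfl fun a ha => Arc.orient_toEdge (h.mem a ha).2.2.2
  have hred : ∀ i j, U.HasEdge .red i j → ∃ hij, (⟨i, j, hij, .red⟩ : Arc X) ∈ G := by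
    rintro i j ⟨e, he, rfl, rfl, hc⟩
    refine ⟨e.lt.ne, ?_⟩
    rw [← e.orient_red hc, ← hUG]
    exact Multiset.mem_map_of_mem _ he
  have hblue : ∀ i j, U.HasEdge .blue i j → ∃ hij, (⟨j, i, hij, .blue⟩ : Arc X) ∈ G := by
    rintro i j ⟨e, he, rfl, rfl, hc⟩
    refine ⟨e.lt.ne', ?_⟩
    rw [← e.orient_blue hc, ← hUG]
    exact Multiset.mem_map_of_mem _ he
  refine ⟨U, ⟨⟨?_, ?_⟩, ?_, ?_, ?_⟩, hUG⟩
  · rw [hU, Multiset.map_map]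
    exact h.nodup_edges
  · rw [← Graph.toSimpleGraph_orientedCopy, hUG]
    exact h.isTree
  · rintro ⟨i, j, k, hij, hjk, h1, h2⟩
    obtain ⟨_, m1⟩ := hred _ _ h1
    obtain ⟨_, m2⟩ := hred _ _ h2
    exact hij.ne (congrArg Arc.src (h.eq_of_tgt _ m1 _ m2 rfl))
  · rintro ⟨i, j, k, hij, hjk, h1, h2⟩
    obtain ⟨_, m1⟩ := hblue _ _ h1
    obtain ⟨_, m2⟩ := hblue _ _ h2
    exact hjk.ne (congrArg Arc.src (h.eq_of_tgt _ m1 _ m2 rfl))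
  · rintro ⟨i, j, k, hij, hjk, h1, h2⟩
    obtain ⟨_, m1⟩ := hred _ _ h1
    obtain ⟨_, m2⟩ := hblue _ _ h2
    exact (hij.trans hjk).ne (congrArg Arc.src (h.eq_of_tgt _ m1 _ m2 rfl))

end RootedTree

/-- Two distinct edges oriented into the same letter form a forbidden pattern: `1r3r2` if both are
red, `2b1b3` if both are blue, `1r2b3` if the colours differ. -/
theorem eq_of_orient_tgt {U : Graph X} (hU : U ∈ avoidingTrees X) {e f : Edge X} (he : e ∈ U)
    (hf : f ∈ U) (h : e.orient.tgt = f.orient.tgt) : e = f := by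
  obtain ⟨-, h1, h2, h3⟩ := hU
  have heq : e.lo = f.lo → e.hi = f.hi → e.color = f.color → e = f := by
    intro a1 a2 a3; cases e; cases f; simp only at a1 a2 a3; subst a1 a2 a3; rfl
  cases hec : e.color <;> cases hfc : f.color
  · rw [e.orient_red hec, f.orient_red hfc] at h
    change e.hi = f.hi at h
    rcases lt_trichotomy e.lo f.lo with hlt | heq' | hlt
    · exact absurd ⟨_, _, _, hlt, f.lt, ⟨e, he, rfl, h, hec⟩, ⟨f, hf, rfl, rfl, hfc⟩⟩ h1
    · exact heq heq' h (hec.trans hfc.symm)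
    · exact absurd ⟨_, _, _, hlt, e.lt, ⟨f, hf, rfl, h.symm, hfc⟩, ⟨e, he, rfl, rfl, hec⟩⟩ h1
  · rw [e.orient_red hec, f.orient_blue hfc] at h
    change e.hi = f.lo at h
    exact absurd ⟨_, _, _, e.lt, h ▸ f.lt, ⟨e, he, rfl, rfl, hec⟩, ⟨f, hf, h.symm, rfl, hfc⟩⟩ h3
  · rw [e.orient_blue hec, f.orient_red hfc] at h
    change e.lo = f.hi at h
    exact absurd ⟨_, _, _, f.lt, h ▸ e.lt, ⟨f, hf, rfl, rfl, hfc⟩, ⟨e, he, h, rfl, hec⟩⟩ h3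
  · rw [e.orient_blue hec, f.orient_blue hfc] at h
    change e.lo = f.lo at h
    rcases lt_trichotomy e.hi f.hi with hlt | heq' | hlt
    · exact absurd ⟨_, _, _, e.lt, hlt, ⟨e, he, rfl, rfl, hec⟩, ⟨f, hf, h.symm, rfl, hfc⟩⟩ h2
    · exact heq h heq' (hec.trans hfc.symm)
    · exact absurd ⟨_, _, _, f.lt, hlt, ⟨f, hf, rfl, rfl, hfc⟩, ⟨e, he, h, rfl, hec⟩⟩ h2

theorem Graph.IsTree.card_add_one_le [Fintype X] {U : Graph X} (hU : U.IsTree) :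
    U.card + 1 ≤ Fintype.card X := by
  classical
  have h1 := (SimpleGraph.isTree_iff_connected_and_card.mp hU.2).2
  rw [Nat.card_eq_fintype_card (α := X)] at h1
  rw [← h1]
  refine Nat.add_le_add_right ?_ 1
  have h2 : (U.map fun e => (e.lo, e.hi)).toFinset.card = U.card := by
    rw [Multiset.toFinset_card_of_nodup hU.1, Multiset.card_map]
  rw [← h2, ← Set.ncard_coe_finset]
  refine Set.ncard_le_ncard_of_injOn (fun p => s(p.1, p.2)) ?_ ?_ (Set.toFinite _)
  · rintro ⟨i, j⟩ hp
    rw [Finset.mem_coe, Multiset.mem_toFinset, Multiset.mem_map] at hp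
    obtain ⟨e, he, heq⟩ := hp
    rw [Prod.mk.injEq] at heq
    obtain ⟨rfl, rfl⟩ := heq
    show s(e.lo, e.hi) ∈ U.toSimpleGraph.edgeSet
    rw [SimpleGraph.mem_edgeSet, Graph.toSimpleGraph, SimpleGraph.fromRel_adj]
    exact ⟨e.lt.ne, Or.inl ⟨e, he, rfl, rfl⟩⟩
  · rintro ⟨i, j⟩ hp ⟨i', j'⟩ hq h
    rw [Finset.mem_coe, Multiset.mem_toFinset, Multiset.mem_map] at hp hq
    obtain ⟨e, -, heq⟩ := hp
    obtain ⟨f, -, hfq⟩ := hq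
    rw [Prod.mk.injEq] at heq hfq
    obtain ⟨rfl, rfl⟩ := heq
    obtain ⟨rfl, rfl⟩ := hfq
    rcases Sym2.eq_iff.mp h with ⟨a, b⟩ | ⟨a, b⟩
    · exact Prod.ext a b
    · have hlt := e.lt
      simp only at a b
      rw [a, b] at hlt
      exact absurd f.lt hlt.not_gt

/-- A tree has too few arcs to enter every letter, so some `r` is not entered and serves as root.
While a rooted subtree grows from `r`, no arc can come in from outside: its target would be `r` or a
letter already entered. -/
theorem exists_rootedTree_of_mem_avoidingTrees [Fintype X] {U : Graph X}
    (hU : U ∈ avoidingTrees X) : ∃ r, RootedTree Finset.univ r U.orientedCopy := by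
  classical
  have hcard := hU.1.card_add_one_le
  have hconn : U.orientedCopy.toSimpleGraph.Connected := by
    rw [Graph.toSimpleGraph_orientedCopy]; exact hU.1.2.connected
  have huniq : ∀ a ∈ U.orientedCopy, ∀ b ∈ U.orientedCopy, a.tgt = b.tgt → a = b := by
    intro a ha b hb hab
    obtain ⟨e, he, rfl⟩ := Multiset.mem_map.mp ha
    obtain ⟨f, hf, rfl⟩ := Multiset.mem_map.mp hb
    rw [eq_of_orient_tgt hU he hf hab]
  have hcolor : ∀ a ∈ U.orientedCopy, {a} = outArc a.src a.tgt := by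
    intro a ha
    obtain ⟨e, -, rfl⟩ := Multiset.mem_map.mp ha
    rw [outArc_of_ne e.orient.ne, ← e.orient_color]
  obtain ⟨r, hr⟩ : ∃ r, ∀ a ∈ U.orientedCopy, a.tgt ≠ r := by
    by_contra hcon
    push Not at hcon
    have hsub : (Finset.univ : Finset X) ⊆ (U.orientedCopy.map Arc.tgt).toFinset := by
      intro v _
      obtain ⟨a, ha, hv⟩ := hcon v
      exact Multiset.mem_toFinset.mpr (Multiset.mem_map.mpr ⟨a, ha, hv⟩)
    have h1 := (Finset.card_le_card hsub).trans (Multiset.toFinset_card_le _)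
    rw [Multiset.card_map, Graph.orientedCopy, Multiset.card_map, Finset.card_univ] at h1
    omega
  refine ⟨r, ?_⟩
  have key : ∀ k : ℕ, ∃ (Y : Finset X) (T H : OGraph X), U.orientedCopy = T + H ∧
      RootedTree Y r T ∧ (Y = Finset.univ ∨ k < Y.card) := by
    intro k
    induction k with
    | zero => exact ⟨{r}, 0, _, (zero_add _).symm, .point r, by simp⟩
    | succ k ih =>
      obtain ⟨Y, T, H, hTH, hT, hY⟩ := ih
      by_cases hu : Y = Finset.univ
      · exact ⟨Y, T, H, hTH, hT, Or.inl hu⟩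
      obtain ⟨z, hz⟩ : ∃ z, z ∉ Y := by
        by_contra h; push Not at h; exact hu (by ext; simp [h])
      obtain ⟨a, ha, w, x, hw, hx, hj⟩ := OGraph.exists_boundary hconn hT.root_mem hz
      rcases hj with ⟨rfl, rfl⟩ | ⟨rfl, rfl⟩
      · have haH : a ∈ H := by
          have ha' := ha
          rw [hTH, Multiset.mem_add] at ha'
          exact ha'.resolve_left fun haT => hx (hT.mem a haT).2.1
        obtain ⟨H', rfl⟩ := Multiset.exists_cons_of_mem haH
        refine ⟨_, _, H', ?_, hT.graft hw hx, Or.inr ?_⟩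
        · rw [hTH, ← hcolor a ha, ← Multiset.singleton_add]; abel
        · rw [Finset.card_insert_of_notMem hx]
          have := hY.resolve_left hu
          omega
      · obtain ⟨b, hb, hba⟩ := hT.exists_tgt a.tgt hw (hr a ha)
        have hbU : b ∈ U.orientedCopy := by rw [hTH]; simp [hb]
        have hab := huniq b hbU a ha hba
        exact absurd (hab ▸ (hT.mem b hb).1) hx
  obtain ⟨Y, T, H, hTH, hT, hY⟩ := key (Fintype.card X)
  obtain rfl : Y = Finset.univ := hY.resolve_right (not_lt.mpr (Finset.card_le_univ Y))
  have h1 := hT.card_add_one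
  have h2 := congrArg Multiset.card hTH
  rw [Graph.orientedCopy, Multiset.card_map, Multiset.card_add] at h2
  rw [Finset.card_univ] at h1
  have h3 : H = 0 := Multiset.card_eq_zero.mp (by omega)
  rw [hTH, h3, add_zero]
  exact hT

theorem orientedTrees_eq [Fintype X] :
    orientedTrees X = {G | ∃ r, RootedTree Finset.univ r G} := by
  ext G
  constructor
  · rintro ⟨U, hU, rfl⟩
    exact exists_rootedTree_of_mem_avoidingTrees hU
  · rintro ⟨r, hr⟩
    exact hr.mem_orientedTrees

end EilTwo

namespace EilTwo

variable (R : Type*) [CommRing R] (X : Type*) [LinearOrder X] [Fintype X]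

/-! ### The basis -/

theorem linearIndependent_orientedTrees :
    LinearIndependent R fun G : orientedTrees X => Eil.mk R (G : OGraph X) := by
  rw [linearIndependent_iff]
  intro l hl
  set x : Gam R X := Finsupp.mapDomain Subtype.val l with hx
  have hlx : Finsupp.linearCombination R (fun G : orientedTrees X => Eil.mk R (G : OGraph X)) l =
      (relations R X).mkQ x := by
    rw [hx, Finsupp.linearCombination_apply, Finsupp.mapDomain, map_finsuppSum]
    refine Finsupp.sum_congr fun G _ => ?_
    rw [Eil.mk, ← map_smul, single, Finsupp.smul_single, smul_eq_mul, mul_one]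
  rw [hl, eq_comm, Submodule.mkQ_apply, Submodule.Quotient.mk_eq_zero] at hlx
  have hx0 : x = 0 := by
    refine eq_zero_of_functional_eq_zero Finset.univ x (fun G hG => ?_)
      fun T hT hl => BinTree.functional_relations hT hl hlx
    classical
    obtain ⟨G', -, rfl⟩ := Finset.mem_image.mp (Finsupp.mapDomain_support hG)
    exact orientedTrees_eq.subset G'.2
  exact Finsupp.mapDomain_injective Subtype.val_injective (hx0.trans Finsupp.mapDomain_zero.symm)

theorem span_orientedTrees :
    ⊤ ≤ Submodule.span R (Set.range fun G : orientedTrees X => Eil.mk R (G : OGraph X)) := by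
  set S := Submodule.span R (Set.range fun G : orientedTrees X => Eil.mk R (G : OGraph X)) with hS
  have hsup : relations R X ⊔ Submodule.span R
      {x | ∃ r G, RootedTree Finset.univ r G ∧ x = single R G} ≤ S.comap (relations R X).mkQ := by
    refine sup_le (fun x hx => ?_) (Submodule.span_le.mpr ?_)
    · rw [Submodule.mem_comap, Submodule.mkQ_apply, (Submodule.Quotient.mk_eq_zero _).mpr hx]
      exact S.zero_mem
    · rintro x ⟨r, G, hG, rfl⟩
      exact Submodule.subset_span ⟨⟨G, hG.mem_orientedTrees⟩, rfl⟩
  rintro y -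
  obtain ⟨x, rfl⟩ := (relations R X).mkQ_surjective y
  change x ∈ S.comap (relations R X).mkQ
  induction x using Finsupp.induction_linear with
  | zero => exact Submodule.zero_mem _
  | add f g hf hg => exact Submodule.add_mem _ hf hg
  | single G a =>
    have : Finsupp.single G a = a • single R G := by
      rw [single, Finsupp.smul_single, smul_eq_mul, mul_one]
    rw [this]
    exact Submodule.smul_mem _ _ (hsup (single_mem_relations_sup G))

/-- The basis of `Eil_2` given by the oriented copies of the pattern-avoiding trees. -/
noncomputable def orientedTreesBasis : Module.Basis (orientedTrees X) R (Eil R X) :=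
  Module.Basis.mk (linearIndependent_orientedTrees R X) (span_orientedTrees R X)

end EilTwo

theorem mainTheorem6 (R : Type*) [CommRing R] (X : Type*) [LinearOrder X] [Fintype X]
    (n : ℕ) (hn : 1 ≤ n) (hX : Fintype.card X = n) :
    -- `Eil_2(n)` is free of rank `n ^ (n - 1)`
    (Module.Free R (EilTwo.Eil R X) ∧
      Nonempty (EilTwo.Eil R X ≃ₗ[R] (Fin (n ^ (n - 1)) → R)) ∧
      (Nontrivial R → Module.finrank R (EilTwo.Eil R X) = n ^ (n - 1))) ∧
    -- the classes of the graphs in `O_n(X)` form a basis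
    ∃ b : Module.Basis (EilTwo.orientedTrees X) R (EilTwo.Eil R X),
      ∀ G : EilTwo.orientedTrees X, b G = EilTwo.Eil.mk R (G : EilTwo.OGraph X) := by
  have hcard : Nat.card (EilTwo.orientedTrees X) = n ^ (n - 1) := by
    rw [Nat.card_coe_set_eq, EilTwo.orientedTrees_eq, EilTwo.ncard_rootedTrees (hX ▸ hn), hX]
  -- `Nat.card` is `0` on infinite types, so finiteness is read off from `n ^ (n - 1) ≠ 0`, where `1
  -- ≤ n` enters.
  have : Finite (EilTwo.orientedTrees X) :=
    Nat.finite_of_card_ne_zero (by rw [hcard]; exact (pow_pos hn _).ne')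
  have b := (EilTwo.orientedTreesBasis R X).reindex (Finite.equivFinOfCardEq hcard)
  refine ⟨⟨.of_basis b, ⟨b.equivFun⟩, fun _ => ?_⟩, EilTwo.orientedTreesBasis R X, fun G => ?_⟩
  · rw [Module.finrank_eq_card_basis b, Fintype.card_fin]
  · rw [EilTwo.orientedTreesBasis, Module.Basis.mk_apply]
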